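/- Let $Q$ be a finite acyclic quiver, i.e. a directed graph with finite vertex set $Q_0$ and finite arrow set $Q_1$ (an arrow $a$ goes from its tail $ta$ to its head $ha$) in which every closed path is trivial. Let $\mathbb F$ be any field, let $W$ be a finite-dimensional representation of $Q$ over $\mathbb F$, and let $\alpha: Q_0\to\mathbb N$ be a dimension vector. For dimension vectors $\alpha,\beta$ put $$\langle\alpha,\beta\rangle=\sum_{x\in Q_0}\alpha(x)\beta(x)-\sum_{a\in Q_1}\alpha(ta)\beta(ha),$$ and write $\underline{\dim}\,U$ for the dimension vector of a representation $U$. For a dimension vector $\gamma$ let $\operatorname{Rep}_\gamma(Q)=\prod_{a\in Q_1}\operatorname{Hom}(\mathbb F^{\gamma(ta)},\mathbb F^{\gamma(ha)})$ be the space of representations with dimension vector $\gamma$. Call $V\in\operatorname{Rep}_\gamma(Q)$ $(\gamma,W)$-general if $\dim\operatorname{Hom}_Q(V,W)$ is the minimal value of $\dim \operatorname{Hom}_Q(\cdot,W)$ on $\operatorname{Rep}_\gamma(Q)$, and put $\hom(\gamma,W)=\dim\operatorname{Hom}_Q(V,W)$ and $\operatorname{ext}(\gamma,W)=\dim\operatorname{Ext}^1_Q(V,W)$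 for a $(\gamma,W)$-general $V$. Then, for all $d\in\mathbb N$, the numbers $\hom(d\alpha,W)$ and $\operatorname{ext}(d\alpha,W)$ do not depend on the choice of the $(d\alpha,W)$-general representation; the limits $$\operatorname{ncext}(\alpha,W)=\lim_{d\to\infty}\frac{\operatorname{ext}(d\alpha,W)}{d},\qquad \operatorname{nchom}(\alpha,W)=\lim_{d\to\infty}\frac{\hom(d\alpha,W)}{d}$$ exist; and $$\operatorname{ncext}(\alpha,W)=\max\{-\langle\alpha,\underline{\dim}\,W''\rangle \mid W''\text{ a factor representation of }W\},$$ $$\operatorname{nchom}(\alpha,W)=\max\{\langle\alpha,\underline{\dim}\,W'\rangle \mid W'\text{ a subrepresentation of }W\}.$$ In particular $\operatorname{nchom}(\alpha,W)=\langle\alpha,\underline{\dim}\,W'\rangle$ for some subrepresentation $W'$ of $W$. -/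

import Mathlib

open CategoryTheory Filter Topology

universe u v w

namespace QuiverNC

/-- The category of representations over `F` of a quiver `Q`: functors from the path category of
`Q` to `F`-vector spaces. Such a functor amounts to a vector space for each vertex and a linear map
for each arrow, and a natural transformation to a family of linear maps commuting with the arrows.
Finite-dimensionality is imposed separately. -/
abbrev QuiverRep (F : Type u) [Field F] (Q : Type v) [Quiver.{w} Q] :=
  Paths Q ⥤ ModuleCat.{u} F

/-- A quiver is acyclic if every closed path in it is trivial. -/
def IsAcyclic (Q : Type v) [Quiver.{w} Q] : Prop :=
  ∀ (x : Q) (p : Quiver.Path x x), p.length = 0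

section

variable {F : Type u} [Field F] {Q : Type v} [Quiver.{w} Q]

/-- The dimension vector of a representation. -/
noncomputable def dimVec (W : QuiverRep F Q) (x : Q) : ℕ :=
  Module.finrank F (W.obj ((Paths.of Q).obj x))

/-- The dimension of `Hom_Q(V, W)`. -/
noncomputable def homDim (V W : QuiverRep F Q) : ℕ :=
  Module.finrank F (V ⟶ W)

/-- The dimension of `Ext_Q(V, W)`, the first `Ext` space in the category of representations. -/
noncomputable def extDim (V W : QuiverRep F Q) : ℕ :=
  letI := HasExt.standard (QuiverRep F Q)
  Module.finrank F (Abelian.Ext V W 1)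

/-- The Euler form `⟨α, β⟩ = ∑ₓ α(x) β(x) - ∑ₐ α(ta) β(ha)` of a finite quiver. -/
def eulerForm [Fintype Q] [∀ x y : Q, Fintype (x ⟶ y)] (α β : Q → ℕ) : ℤ :=
  ∑ x : Q, (α x : ℤ) * β x - ∑ x : Q, ∑ y : Q, ∑ _a : x ⟶ y, (α x : ℤ) * β y

variable (F) in
/-- The representation space `Rep_α(Q)`: all families of linear maps `F^{α(ta)} → F^{α(ha)}`. -/
def RepSpace (α : Q → ℕ) : Type (max u v w) :=
  ∀ ⦃x y : Q⦄, (x ⟶ y) → ((Fin (α x) → F) →ₗ[F] (Fin (α y) → F))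

/-- A point of `Rep_α(Q)`, regarded as a representation of `Q`. -/
def RepSpace.toRep {α : Q → ℕ} (V : RepSpace F α) : QuiverRep F Q :=
  Paths.lift
    { obj := fun x => ModuleCat.of F (Fin (α x) → F)
      map := fun a => ModuleCat.ofHom (V a) }

/-- `V` is `(α, W)`-general: `dim Hom_Q(V, W)` is the minimal value of `dim Hom_Q(-, W)`
on `Rep_α(Q)`. -/
def IsGeneral {α : Q → ℕ} (W : QuiverRep F Q) (V : RepSpace F α) : Prop :=
  ∀ V' : RepSpace F α, homDim V.toRep W ≤ homDim V'.toRep W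

theorem exists_isGeneral (α : Q → ℕ) (W : QuiverRep F Q) :
    ∃ V : RepSpace F α, IsGeneral W V := by
  have : Nonempty (RepSpace F α) := ⟨fun _ _ _ => 0⟩
  exact ⟨Function.argmin (fun V : RepSpace F α => homDim V.toRep W),
    fun V' => Function.argmin_le (fun V : RepSpace F α => homDim V.toRep W) V'⟩

/-- `hom(α, W) = dim Hom_Q(V, W)` for an `(α, W)`-general `V`. -/
noncomputable def genHom (α : Q → ℕ) (W : QuiverRep F Q) : ℕ :=
  homDim (exists_isGeneral α W).choose.toRep W

/-- `ext(α, W) = dim Ext_Q(V, W)` for an `(α, W)`-general `V`. -/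
noncomputable def genExt (α : Q → ℕ) (W : QuiverRep F Q) : ℕ :=
  extDim (exists_isGeneral α W).choose.toRep W

/-- `nchom(α, W) = lim_{d → ∞} hom(dα, W) / d`. -/
noncomputable def ncHom (α : Q → ℕ) (W : QuiverRep F Q) : ℝ :=
  limUnder atTop (fun d : ℕ => (genHom (d • α) W : ℝ) / d)

/-- `ncext(α, W) = lim_{d → ∞} ext(dα, W) / d`. -/
noncomputable def ncExt (α : Q → ℕ) (W : QuiverRep F Q) : ℝ :=
  limUnder atTop (fun d : ℕ => (genExt (d • α) W : ℝ) / d)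

end

end QuiverNC

/-! For a subrepresentation `W'` of `W` and `V` of dimension vector `dα`, `dim Hom(V, W) ≥ dim
Hom(V, W') ≥ d⟨α, dim W'⟩`, which bounds the slope from below. Direct sums make `hom(dα, W)`
subadditive in `d`, so by Fekete's lemma the limit exists and is the infimum of `hom(dα, W)/d`. It
remains to bound this infimum from above.

The core is `exists_finrank_homSpace_le`. Take `V` with `Hom(V, M)` of minimal dimension and, among
all such `V`, a homomorphism `f : V → M` of maximal rank. Deform `V` to `V + X V'`. By minimality
`f` lifts to a homomorphism `f + X m₁ + …`, so `M m₁ - m₁ V = f V'`; by maximality of the rank, `m₁`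
maps `ker f` into `im f`. Counting the dimension of the space of such `m₁` gives `dim Hom(V, M) ≤
⟨α, dim (im f)⟩ + ∑ₓ rank fₓ · dim Mₓ`. The image of `f` is a subrepresentation and the error is
bounded independently of `α`, so for `dα` it disappears after division by `d`.

The deformation lives over `K(X)`, and `F` may be finite. Hence both extrema are taken over all `K`
and `M` satisfying `Descends`, a property stable under `K ↦ K(X)`. Subrepresentations return to `K`
by specialization at `X = 0`. Bounds on `Hom` return by replacing `K(X)` with a finite-dimensional
`K`-algebra; this multiplies the dimension vector by some `N`, which is harmless in the limit.

The statement on `ext` follows from `homDim_sub_extDim`, a consequence of the standard injective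
coresolution of `W`. -/

namespace QuiverNC

open Polynomial

/-! ### Limits at `X = 0` of subspaces over `K(X)` -/

section Specialization

variable {K : Type*} [Field K] {L : Type*} [Field L] [Algebra K[X] L] [IsFractionRing K[X] L]
variable {κ : Type*} [Fintype κ]

/-- Divide by `X` as long as all constant terms vanish; each division lowers the degree of the
nonzero entry `m i`, so this stops. -/
theorem exists_eq_X_pow_mul (n : ℕ) (m : κ → K[X]) (i : κ) (hi : m i ≠ 0)
    (hn : (m i).natDegree ≤ n) :
    ∃ (k : ℕ) (m' : κ → K[X]), (∀ j, m j = X ^ k * m' j) ∧ ∃ j, (m' j).coeff 0 ≠ 0 := by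
  induction n generalizing m with
  | zero =>
    refine ⟨0, m, by simp, i, fun h => hi ?_⟩
    rw [eq_C_of_natDegree_le_zero hn, h, map_zero]
  | succ n ih =>
    by_cases h : ∃ j, (m j).coeff 0 ≠ 0
    · exact ⟨0, m, by simp, h⟩
    push Not at h
    have hX : ∀ j, m j = X * (m j).divX := fun j => by
      conv_lhs => rw [← divX_mul_X_add (m j), h j, map_zero, add_zero, mul_comm]
    have h0 : (m i).divX ≠ 0 := fun h0 => hi (by rw [hX i, h0, mul_zero])
    obtain ⟨k, m', hm, hj⟩ := ih (fun j => (m j).divX) h0 (by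
      rw [natDegree_divX_eq_natDegree_tsub_one]; lia)
    exact ⟨k + 1, m', fun j => by rw [hX j, hm j]; ring, hj⟩

/-- A nonzero vector of rational functions can be rescaled to a vector of polynomials that does
not vanish at `0`. -/
theorem exists_primitive_multiple (x : κ → L) (hx : x ≠ 0) :
    ∃ c : L, c ≠ 0 ∧ ∃ m : κ → K[X], (∀ i, algebraMap K[X] L (m i) = c * x i) ∧
      ∃ i, (m i).coeff 0 ≠ 0 := by
  classical
  obtain ⟨b, hb⟩ := IsLocalization.exist_integer_multiples_of_finset (nonZeroDivisors K[X])
    (Finset.univ.image x)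
  have hb' : ∀ i, ∃ m : K[X], algebraMap K[X] L m = algebraMap K[X] L b * x i := fun i => by
    obtain ⟨m, hm⟩ := hb (x i) (by simp)
    exact ⟨m, by rw [hm, Algebra.smul_def]⟩
  choose m hm using hb'
  have hb0 : algebraMap K[X] L b ≠ 0 := IsLocalization.to_map_ne_zero_of_mem_nonZeroDivisors L
    le_rfl b.2
  obtain ⟨i, hi⟩ := Function.ne_iff.mp hx
  obtain ⟨k, m', hm', hj⟩ := exists_eq_X_pow_mul (m i).natDegree m i (fun h => by
    have := hm i
    rw [h, map_zero] at this
    exact mul_ne_zero hb0 hi this.symm) le_rfl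
  have hX : algebraMap K[X] L X ≠ 0 := fun h => X_ne_zero (R := K)
    (IsFractionRing.injective K[X] L (by rw [h, map_zero]))
  refine ⟨(algebraMap K[X] L X ^ k)⁻¹ * algebraMap K[X] L b, mul_ne_zero (by positivity) hb0, m',
    fun j => ?_, hj⟩
  rw [mul_assoc, ← hm j, hm' j, map_mul, map_pow, inv_mul_cancel_left₀ (by positivity)]

variable (K) in
/-- The specialization at `0` of a subspace of vectors of rational functions. -/
def specialization (S : Submodule L (κ → L)) : Submodule K (κ → K) where
  carrier := {v | ∃ m : κ → K[X], (fun i => algebraMap K[X] L (m i)) ∈ S ∧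
    ∀ i, (m i).coeff 0 = v i}
  zero_mem' := ⟨0, by simp only [Pi.zero_apply, map_zero]; exact S.zero_mem, by simp⟩
  add_mem' := by
    rintro v v' ⟨m, hm, hv⟩ ⟨m', hm', hv'⟩
    refine ⟨m + m', ?_, fun i => by simp [hv, hv']⟩
    convert S.add_mem hm hm' using 1
    ext i
    simp
  smul_mem' := by
    rintro c v ⟨m, hm, hv⟩
    refine ⟨fun i => C c * m i, ?_, fun i => by simp [hv]⟩
    convert S.smul_mem (algebraMap K[X] L (C c)) hm using 1
    ext i
    simp

omit [IsFractionRing K[X] L] [Fintype κ] in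
theorem coeff_zero_mem_specialization {S : Submodule L (κ → L)} {m : κ → K[X]}
    (hm : (fun i => algebraMap K[X] L (m i)) ∈ S) :
    (fun i => (m i).coeff 0) ∈ specialization K S := ⟨m, hm, fun _ => rfl⟩

/-- This equality of dimensions makes subrepresentations descend, and turns minimality of `Hom` into
liftability of homomorphisms. -/
theorem finrank_specialization (S : Submodule L (κ → L)) :
    Module.finrank K (specialization K S) = Module.finrank L S := by
  classical
  have hinj := IsFractionRing.injective K[X] L
  set k := Module.finrank K (specialization K S) with hk
  let b := Module.finBasis K (specialization K S)
  apply le_antisymm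
  -- Polynomial lifts of a basis of the specialization are independent: a relation, rescaled to be
  -- primitive, would specialize to a nontrivial relation at `0`.
  · choose m hm hmb using fun j => (b j).2
    have hli : LinearIndependent L (fun j => (⟨_, hm j⟩ : S)) := by
      rw [Fintype.linearIndependent_iff]
      by_contra! hc
      obtain ⟨g, hg, j₀, hj₀⟩ := hc
      obtain ⟨c, hc, p, hp, j, hj⟩ := exists_primitive_multiple (K := K) g
        (fun h => hj₀ (congrFun h j₀))
      have h1 : ∀ i, ∑ j, p j * m j i = 0 := fun i => hinj (by
        have := congrFun (congrArg Subtype.val hg) i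
        simp only [AddSubmonoidClass.coe_finsetSum, Submodule.coe_smul, Finset.sum_apply,
          Pi.smul_apply, smul_eq_mul, Submodule.coe_zero, Pi.zero_apply] at this
        rw [map_sum, map_zero]
        simp only [map_mul, hp, mul_assoc]
        rw [← Finset.mul_sum, this, mul_zero])
      have h2 : ∑ j, (p j).coeff 0 • b j = 0 := by
        ext i
        have := congrArg (fun q : K[X] => q.coeff 0) (h1 i)
        simp only [finsetSum_coeff, mul_coeff_zero, hmb, coeff_zero] at this
        simpa using this
      exact hj (Fintype.linearIndependent_iff.mp b.linearIndependent _ h2 j)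
    simpa using hli.fintype_card_le_finrank
  -- A projection onto the specialization, with scalars extended to `L`, is injective on `S`: a
  -- kernel vector, made primitive, has a nonzero value at `0` that the projection both fixes and
  -- kills.
  · obtain ⟨q, hq⟩ := (specialization K S).subtype.exists_leftInverse_of_injective
      (Submodule.ker_subtype _)
    let P := LinearMap.toMatrix' (b.equivFun.toLinearMap ∘ₗ q)
    let g : S →ₗ[L] (Fin k → L) :=
      (P.map ((algebraMap K[X] L).comp C)).mulVecLin ∘ₗ S.subtype
    have hg : Function.Injective g := by
      rw [injective_iff_map_eq_zero]
      intro x hx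
      by_contra hx0
      obtain ⟨c, hc, m, hm, j, hj⟩ := exists_primitive_multiple (K := K) x.1
        (fun h => hx0 (Subtype.ext h))
      have hmS : (fun i => algebraMap K[X] L (m i)) ∈ S := by
        rw [funext hm]
        exact S.smul_mem c x.2
      have h1 : ∀ i, ∑ j, C (P i j) * m j = 0 := fun i => hinj (by
        have := congrFun hx i
        simp only [g, LinearMap.comp_apply, Submodule.subtype_apply, Matrix.mulVecLin_apply,
          Matrix.mulVec, dotProduct, Matrix.map_apply, RingHom.comp_apply, Pi.zero_apply] at this
        rw [map_sum, map_zero]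
        simp only [map_mul, hm, mul_left_comm _ c]
        rw [← Finset.mul_sum, this, mul_zero])
      set v : specialization K S := ⟨_, coeff_zero_mem_specialization hmS⟩
      have h2 : P.mulVec v.1 = 0 := by
        ext i
        have := congrArg (fun q : K[X] => q.coeff 0) (h1 i)
        simp only [finsetSum_coeff, mul_coeff_zero, coeff_C_zero, coeff_zero] at this
        exact this
      have h3 : b.equivFun v = 0 := by
        rw [← h2, LinearMap.toMatrix'_mulVec, LinearMap.comp_apply]
        exact congrArg b.equivFun (LinearMap.congr_fun hq v).symm
      have h4 : v = 0 := by simpa using h3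
      exact hj (congrFun (congrArg Subtype.val h4) j)
    simpa using LinearMap.finrank_le_finrank_of_injective hg

end Specialization

/-! ### Kernels of polynomial matrices over finite-dimensional algebras -/

section PolynomialMatrix

/-- A nonzero polynomial becomes invertible in some nonzero finite-dimensional quotient of the
polynomial ring. -/
theorem exists_finite_algebra_isUnit {K : Type u} [Field K] (P : K[X]) (hP : P ≠ 0) :
    ∃ (A : Type u) (_ : CommRing A) (_ : Algebra K A) (_ : Algebra K[X] A)
      (_ : IsScalarTower K K[X] A), FiniteDimensional K A ∧ Nontrivial A ∧
      IsUnit (algebraMap K[X] A P) := by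
  -- Modulo `f` the inverse of `P` is `-X`. The factor `X` keeps the degree positive even for
  -- constant `P`, so the quotient is nonzero.
  set f : K[X] := X * P + 1 with hf
  have hdeg : f.natDegree = P.natDegree + 1 := by
    rw [hf, ← C_1, natDegree_add_C, natDegree_X_mul hP]
  have hf0 : f ≠ 0 := fun h => by simp [h] at hdeg
  refine ⟨K[X] ⧸ Ideal.span {f}, inferInstance, inferInstance, inferInstance, inferInstance,
    (AdjoinRoot.powerBasis hf0).finite, ?_, ?_⟩
  · refine AdjoinRoot.nontrivial f ?_
    rw [degree_eq_natDegree hf0, hdeg]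
    exact_mod_cast P.natDegree.succ_ne_zero
  · refine IsUnit.of_mul_eq_one (-(algebraMap K[X] _ X)) ?_
    have : algebraMap K[X] (K[X] ⧸ Ideal.span {f}) f = 0 :=
      Ideal.Quotient.eq_zero_iff_mem.mpr (Ideal.mem_span_singleton_self f)
    rw [hf, map_add, map_mul, map_one] at this
    linear_combination -this

variable {K : Type*} [Field K] {L : Type*} [Field L] [Algebra K[X] L] [IsFractionRing K[X] L]
variable {κ κ' : Type*} [Fintype κ] [Fintype κ']

theorem exists_matrix_polynomial_multiple (B : Matrix κ' κ L) :
    ∃ (c : K[X]) (B' : Matrix κ' κ K[X]), c ≠ 0 ∧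
      B'.map (algebraMap K[X] L) = algebraMap K[X] L c • B := by
  classical
  obtain ⟨b, hb⟩ := IsLocalization.exist_integer_multiples_of_finset (nonZeroDivisors K[X])
    (Finset.univ.image fun p : κ' × κ => B p.1 p.2)
  have hb' : ∀ i j, ∃ m : K[X], algebraMap K[X] L m = algebraMap K[X] L b * B i j := fun i j => by
    obtain ⟨m, hm⟩ := hb (B i j) (Finset.mem_image.mpr ⟨(i, j), by simp⟩)
    exact ⟨m, by rw [hm, Algebra.smul_def]⟩
  choose m hm using hb'
  exact ⟨b, Matrix.of m, nonZeroDivisors.ne_zero b.2, by ext i j; simpa using hm i j⟩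

/-- The kernel of a matrix of polynomials, over a finite-dimensional algebra in which a suitable
polynomial is invertible, is at most as big as over the field of rational functions. -/
theorem exists_finrank_ker_le (T : Matrix κ' κ K[X]) :
    ∃ P : K[X], P ≠ 0 ∧ ∀ (A : Type u) [CommRing A] [Algebra K A] [Algebra K[X] A]
      [IsScalarTower K K[X] A] [FiniteDimensional K A], IsUnit (algebraMap K[X] A P) →
      ∀ N : Submodule K (κ → A), (∀ f ∈ N, (T.map (algebraMap K[X] A)).mulVec f = 0) →
      Module.finrank K N ≤
        Module.finrank L (LinearMap.ker (T.map (algebraMap K[X] L)).mulVecLin) *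
          Module.finrank K A := by
  classical
  set S := LinearMap.ker (T.map (algebraMap K[X] L)).mulVecLin with hS
  set h := Module.finrank L S
  obtain ⟨z₀, hz₀⟩ := S.subtype.exists_leftInverse_of_injective (Submodule.ker_subtype _)
  -- `z` gives coordinates on the kernel of `T`, so `T` stacked on `z` has a left inverse. Clearing
  -- denominators yields `G * (T over Z) = P`. Where `P` is invertible, a kernel vector of `T` is
  -- thus determined by the `h` entries of its image under `Z`.
  let z : Matrix (Fin h) κ L :=
    LinearMap.toMatrix' ((Module.finBasis L S).equivFun.toLinearMap ∘ₗ z₀)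
  obtain ⟨d, Z, hd, hZ⟩ := exists_matrix_polynomial_multiple (K := K) z
  have hinj := IsFractionRing.injective K[X] L
  have hd' : algebraMap K[X] L d ≠ 0 := by simpa using hd
  have hker : LinearMap.ker ((Matrix.fromRows T Z).map (algebraMap K[X] L)).mulVecLin = ⊥ := by
    rw [LinearMap.ker_eq_bot']
    intro v hv
    rw [Matrix.mulVecLin_apply, Matrix.fromRows_map, Matrix.fromRows_mulVec] at hv
    have h1 : (T.map (algebraMap K[X] L)).mulVec v = 0 := by
      ext i; exact congrFun hv (Sum.inl i)
    have h2 : (Z.map (algebraMap K[X] L)).mulVec v = 0 := by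
      ext i; exact congrFun hv (Sum.inr i)
    rw [hZ, Matrix.smul_mulVec, smul_eq_zero_iff_right hd', LinearMap.toMatrix'_mulVec,
      LinearMap.comp_apply] at h2
    have h3 : z₀ v = 0 := by simpa using h2
    have h4 := LinearMap.congr_fun hz₀ ⟨v, h1⟩
    simp only [LinearMap.comp_apply, Submodule.subtype_apply, h3, LinearMap.id_apply] at h4
    exact congrArg Subtype.val h4.symm
  obtain ⟨g, hg⟩ := LinearMap.exists_leftInverse_of_injective _ hker
  obtain ⟨P, G, hP, hG⟩ := exists_matrix_polynomial_multiple (K := K) (LinearMap.toMatrix' g)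
  have hGP : G * Matrix.fromRows T Z = P • (1 : Matrix κ κ K[X]) := by
    apply Matrix.map_injective hinj
    have h5 := congrArg LinearMap.toMatrix' hg
    rw [LinearMap.toMatrix'_comp, LinearMap.toMatrix'_id, ← Matrix.toLin'_apply',
      LinearMap.toMatrix'_toLin'] at h5
    beta_reduce
    rw [Matrix.map_mul, hG, Matrix.smul_mul, h5]
    ext i j
    simp [Matrix.one_apply, apply_ite (algebraMap K[X] L)]
  refine ⟨P, hP, fun A _ _ _ _ _ hu N hN => ?_⟩
  let ev : N →ₗ[K] (Fin h → A) :=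
    ((Z.map (algebraMap K[X] A)).mulVecLin.restrictScalars K) ∘ₗ N.subtype
  have hev : Function.Injective ev := by
    rw [injective_iff_map_eq_zero]
    intro f hf
    have h6 : ((Matrix.fromRows T Z).map (algebraMap K[X] A)).mulVec f.1 = 0 := by
      rw [Matrix.fromRows_map, Matrix.fromRows_mulVec, hN f.1 f.2]
      ext (i | i)
      · rfl
      · exact congrFun hf i
    have h7 := congrArg (fun B => (B.map (algebraMap K[X] A)).mulVec f.1) hGP
    simp only [Matrix.map_mul, ← Matrix.mulVec_mulVec, h6, Matrix.mulVec_zero] at h7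
    ext i
    have h8 : algebraMap K[X] A P * f.1 i = 0 := by
      rw [← Pi.zero_apply (M := fun _ : κ => A) i, h7]
      simp [Matrix.mulVec, dotProduct, Matrix.one_apply, apply_ite (algebraMap K[X] A)]
    exact hu.mul_right_eq_zero.mp h8
  have := LinearMap.finrank_le_finrank_of_injective hev
  rwa [Module.finrank_pi_fintype, Finset.sum_const, Finset.card_univ, Fintype.card_fin,
    smul_eq_mul] at this

end PolynomialMatrix

/-! ### Representations and homomorphisms as matrices -/

section MatrixRepresentation

variable {Q : Type v} [Quiver.{w} Q]

/-- Representations of a quiver given by matrices, with rows and columns indexed by `ι`. -/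
abbrev MatRep (R : Type*) (ι : Q → Type) := ∀ ⦃x y : Q⦄, (x ⟶ y) → Matrix (ι y) (ι x) R

variable (Q) in
/-- The arrows of a quiver. -/
abbrev Arrows := Σ x y : Q, (x ⟶ y)

/-- The extension of scalars of a representation given by matrices. -/
def MatRep.map {R S : Type*} [Semiring R] [Semiring S] (θ : R →+* S) {ι : Q → Type}
    (M : MatRep R ι) : MatRep S ι := fun _ _ a => (M a).map θ

/-- The matrix at the vertex `x` in a family of matrices indexed by the vertices. -/
def block {R : Type*} {ω ι : Q → Type} (f : (Σ x : Q, ω x × ι x) → R) (x : Q) :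
    Matrix (ω x) (ι x) R := Matrix.of fun i j => f ⟨x, i, j⟩

variable {ω ι : Q → Type} [∀ x, Fintype (ω x)] [∀ x, Fintype (ι x)]

/-- The map `(f_x)_x ↦ (M_a f_{ta} - f_{ha} V_a)_a`. -/
def coboundary {R : Type*} [CommRing R] (M : MatRep R ω) (V : MatRep R ι) :
    ((Σ x : Q, ω x × ι x) → R) →ₗ[R] ((Σ a : Arrows Q, ω a.2.1 × ι a.1) → R) where
  toFun f := fun c => (M c.1.2.2 * block f c.1.1 - block f c.1.2.1 * V c.1.2.2) c.2.1 c.2.2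
  map_add' f g := by
    ext c
    simp only [block, Matrix.sub_apply, Matrix.mul_apply, Matrix.of_apply, Pi.add_apply, mul_add,
      add_mul, Finset.sum_add_distrib]
    ring
  map_smul' r f := by
    ext c
    simp only [block, Matrix.sub_apply, Matrix.mul_apply, Matrix.of_apply, Pi.smul_apply,
      smul_eq_mul, RingHom.id_apply, mul_sub, Finset.mul_sum]
    congr 1 <;> exact Finset.sum_congr rfl fun _ _ => by ring

theorem coboundary_apply {R : Type*} [CommRing R] (M : MatRep R ω) (V : MatRep R ι)
    (f : (Σ x : Q, ω x × ι x) → R) {x y : Q} (a : x ⟶ y) (i : ω y) (j : ι x) :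
    coboundary M V f ⟨⟨x, y, a⟩, i, j⟩ =
      ∑ k, M a i k * f ⟨x, k, j⟩ - ∑ l, f ⟨y, i, l⟩ * V a l j := by
  simp [coboundary, block, Matrix.mul_apply]

/-- The space of homomorphisms between representations given by matrices. -/
def homSpace {R : Type*} [CommRing R] (M : MatRep R ω) (V : MatRep R ι) :
    Submodule R ((Σ x : Q, ω x × ι x) → R) := LinearMap.ker (coboundary M V)

theorem mem_homSpace_iff {R : Type*} [CommRing R] {M : MatRep R ω} {V : MatRep R ι}
    {f : (Σ x : Q, ω x × ι x) → R} :
    f ∈ homSpace M V ↔ ∀ ⦃x y : Q⦄ (a : x ⟶ y), M a * block f x = block f y * V a := by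
  rw [homSpace, LinearMap.mem_ker]
  constructor
  · intro h x y a
    ext i j
    exact sub_eq_zero.mp (congrFun h ⟨⟨x, y, a⟩, i, j⟩)
  · intro h
    ext ⟨⟨x, y, a⟩, i, j⟩
    exact sub_eq_zero.mpr (congrFun (congrFun (h a) i) j)

theorem mem_homSpace_iff_sum {R : Type*} [CommRing R] {M : MatRep R ω} {V : MatRep R ι}
    {f : (Σ x : Q, ω x × ι x) → R} :
    f ∈ homSpace M V ↔ ∀ ⦃x y : Q⦄ (a : x ⟶ y) (i : ω y) (j : ι x),
      ∑ k, M a i k * f ⟨x, k, j⟩ = ∑ l, f ⟨y, i, l⟩ * V a l j := by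
  rw [mem_homSpace_iff]
  refine forall₃_congr fun x y a => ?_
  rw [← Matrix.ext_iff]
  simp [block, Matrix.mul_apply]

theorem coboundary_map {R S : Type*} [CommRing R] [CommRing S] (θ : R →+* S) (M : MatRep R ω)
    (V : MatRep R ι) (f : (Σ x : Q, ω x × ι x) → R) (c) :
    coboundary (M.map θ) (V.map θ) (fun i => θ (f i)) c = θ (coboundary M V f c) := by
  obtain ⟨⟨x, y, a⟩, i, j⟩ := c
  simp [coboundary_apply, MatRep.map]

theorem toMatrix'_coboundary_map {R S : Type*} [CommRing R] [CommRing S] [Fintype Q]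
    [DecidableEq (Σ x : Q, ω x × ι x)] (θ : R →+* S) (M : MatRep R ω) (V : MatRep R ι) :
    (LinearMap.toMatrix' (coboundary M V)).map θ =
      LinearMap.toMatrix' (coboundary (M.map θ) (V.map θ)) := by
  ext c j
  rw [Matrix.map_apply, LinearMap.toMatrix'_apply, LinearMap.toMatrix'_apply, ← coboundary_map]
  refine congrFun (congrArg _ (funext fun i => ?_)) c
  by_cases h : i = j
  · subst h; simp
  · simp [h]

end MatrixRepresentation

/-! ### Descent from `K(X)` to `K` -/

section Descent

variable {Q : Type v} [Quiver.{w} Q] {ω : Q → Type} [∀ x, Fintype (ω x)]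

/-- A family of subspaces stable under the arrows. -/
def IsSubrep {K : Type*} [Field K] (M : MatRep K ω) (S : ∀ x, Submodule K (ω x → K)) : Prop :=
  ∀ ⦃x y : Q⦄ (a : x ⟶ y), ∀ v ∈ S x, (M a).mulVec v ∈ S y

/-- Upper bounds for the dimensions of spaces of homomorphisms, and dimension vectors of
subrepresentations, descend from `M` to `M₀`. -/
structure Descends {F : Type u} [Field F] (M₀ : MatRep F ω) (K : Type u) [Field K]
    (M : MatRep K ω) : Prop where
  rep : ∀ (ι : Q → Type) [∀ x, Fintype (ι x)] (V : MatRep K ι),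
    ∃ (N : ℕ) (ι' : Q → Type) (_ : ∀ x, Fintype (ι' x)) (V' : MatRep F ι'), 0 < N ∧
      (∀ x, Fintype.card (ι' x) = N * Fintype.card (ι x)) ∧
      Module.finrank F (homSpace M₀ V') ≤ N * Module.finrank K (homSpace M V)
  sub : ∀ S : ∀ x, Submodule K (ω x → K), IsSubrep M S →
    ∃ S' : ∀ x, Submodule F (ω x → F), IsSubrep M₀ S' ∧
      ∀ x, Module.finrank F (S' x) = Module.finrank K (S x)

theorem Descends.refl {F : Type u} [Field F] (M : MatRep F ω) : Descends M F M where
  rep ι _ V := ⟨1, ι, inferInstance, V, one_pos, by simp, by simp⟩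
  sub S hS := ⟨S, hS, fun _ => rfl⟩

/-- The matrices of `M` are constant in `X`, so they commute with evaluation at `0`. -/
theorem isSubrep_specialization {K : Type*} [Field K] {L : Type*} [Field L] [Algebra K[X] L]
    [IsFractionRing K[X] L] (M : MatRep K ω) (S : ∀ x, Submodule L (ω x → L))
    (hS : IsSubrep (M.map ((algebraMap K[X] L).comp C)) S) :
    IsSubrep M (fun x => specialization K (S x)) := by
  rintro x y a v ⟨m, hm, hv⟩
  refine ⟨((M a).map C).mulVec m, ?_, fun i => ?_⟩
  · convert hS a _ hm using 1
    ext i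
    simp [Matrix.mulVec, dotProduct, MatRep.map]
  · simp [Matrix.mulVec, dotProduct, hv, mul_coeff_zero]

/-- After clearing denominators, `V` makes sense over a finite-dimensional algebra `A` in which
finitely many polynomials are invertible. Over `K` it becomes a representation `dim A` times as
large, and its homomorphisms to `M` are `A`-valued solutions of the same linear equations. Unlike
evaluation at a point, this also works over finite fields. -/
theorem exists_rep_specialization [Fintype Q] [∀ x y : Q, Fintype (x ⟶ y)] {K : Type u} [Field K]
    {L : Type u} [Field L] [Algebra K[X] L] [IsFractionRing K[X] L] (M : MatRep K ω)
    (ι : Q → Type) [∀ x, Fintype (ι x)] (V : MatRep L ι) :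
    ∃ (N : ℕ) (ι' : Q → Type) (_ : ∀ x, Fintype (ι' x)) (V' : MatRep K ι'), 0 < N ∧
      (∀ x, Fintype.card (ι' x) = N * Fintype.card (ι x)) ∧
      Module.finrank K (homSpace M V') ≤
        N * Module.finrank L (homSpace (M.map ((algebraMap K[X] L).comp C)) V) := by
  classical
  obtain ⟨c, B, hc, hB⟩ := exists_matrix_polynomial_multiple (K := K)
    (Matrix.of fun (_ : Unit) (p : Σ a : Arrows Q, ι a.2.1 × ι a.1) => V p.1.2.2 p.2.1 p.2.2)
  let U : MatRep K[X] ι := fun x y a => Matrix.of fun l j => B () ⟨⟨x, y, a⟩, l, j⟩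
  have hU : ∀ ⦃x y : Q⦄ (a : x ⟶ y) l j,
      algebraMap K[X] L (U a l j) = algebraMap K[X] L c * V a l j := fun x y a l j => by
    have := congrFun (congrFun hB ()) ⟨⟨x, y, a⟩, l, j⟩
    simp only [Matrix.map_apply, Matrix.smul_apply, Matrix.of_apply, smul_eq_mul] at this
    exact this
  -- Scaling `M` by the denominator `c` of `V` leaves the homomorphism equations over `L` unchanged.
  let M' : MatRep K[X] ω := fun x y a => c • (M a).map C
  have hc' : algebraMap K[X] L c ≠ 0 := by
    simpa using (IsFractionRing.injective K[X] L).ne hc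
  have hker : LinearMap.ker ((LinearMap.toMatrix' (coboundary M' U)).map
      (algebraMap K[X] L)).mulVecLin = homSpace (M.map ((algebraMap K[X] L).comp C)) V := by
    rw [toMatrix'_coboundary_map, ← Matrix.toLin'_apply', Matrix.toLin'_toMatrix']
    ext f
    change f ∈ homSpace _ _ ↔ _
    rw [mem_homSpace_iff_sum, mem_homSpace_iff_sum]
    refine forall₅_congr fun x y a i j => ?_
    have h1 : ∑ k, M'.map (algebraMap K[X] L) a i k * f ⟨x, k, j⟩ = algebraMap K[X] L c *
        ∑ k, M.map ((algebraMap K[X] L).comp C) a i k * f ⟨x, k, j⟩ := by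
      simp [M', MatRep.map, Finset.mul_sum, mul_assoc]
    have h2 : ∑ l, f ⟨y, i, l⟩ * U.map (algebraMap K[X] L) a l j = algebraMap K[X] L c *
        ∑ l, f ⟨y, i, l⟩ * V a l j := by
      simp only [MatRep.map, Matrix.map_apply, hU, Finset.mul_sum]
      exact Finset.sum_congr rfl fun _ _ => by ring
    rw [h1, h2, mul_right_inj' hc']
  obtain ⟨P, hP, hA⟩ := exists_finrank_ker_le (L := L) (LinearMap.toMatrix' (coboundary M' U))
  obtain ⟨A, _, _, _, _, _, _, hu⟩ := exists_finite_algebra_isUnit (P * c) (mul_ne_zero hP hc)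
  rw [map_mul, IsUnit.mul_iff] at hu
  obtain ⟨d, hd⟩ := hu.2.exists_right_inv
  let b := Module.finBasis K A
  -- Multiplication by `U * d`, the image of `V` in `A`, written transposed: it acts on the dual of
  -- `A`. Contracting the index `n` of a homomorphism with the basis `b` then gives matrices over
  -- `A`, and composition with `V'` becomes multiplication by `U * d`.
  let V' : MatRep K (fun x => ι x × Fin (Module.finrank K A)) := fun x y a =>
    Matrix.of fun l j => b.repr (algebraMap K[X] A (U a l.1 j.1) * d * b l.2) j.2
  refine ⟨Module.finrank K A, _, inferInstance, V', Module.finrank_pos, fun x => by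
    rw [Fintype.card_prod, Fintype.card_fin, mul_comm], ?_⟩
  let ev : ((Σ x : Q, ω x × (ι x × Fin (Module.finrank K A))) → K) →ₗ[K]
      ((Σ x : Q, ω x × ι x) → A) :=
    LinearMap.pi fun p => ∑ n, (LinearMap.proj ⟨p.1, p.2.1, (p.2.2, n)⟩).smulRight (b n)
  have hev : ∀ f x i j, ev f ⟨x, i, j⟩ = ∑ n, f ⟨x, i, (j, n)⟩ • b n := fun f x i j => by
    simp [ev]
  have hinj : Function.Injective ev := by
    rw [injective_iff_map_eq_zero]
    intro f hf
    ext ⟨x, i, j, n⟩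
    have h1 := congrFun hf ⟨x, i, j⟩
    rw [hev] at h1
    exact Fintype.linearIndependent_iff.mp b.linearIndependent _ h1 n
  rw [← hker, mul_comm, (Submodule.equivMapOfInjective ev hinj _).finrank_eq]
  refine hA A hu.1 _ ?_
  rintro _ ⟨f, hf, rfl⟩
  rw [toMatrix'_coboundary_map, LinearMap.toMatrix'_mulVec]
  change ev f ∈ homSpace _ _
  rw [SetLike.mem_coe, mem_homSpace_iff_sum] at hf
  rw [mem_homSpace_iff_sum]
  intro x y a i j
  have h2 : ∑ k, M a i k • ev f ⟨x, k, j⟩ =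
      ∑ l, ev f ⟨y, i, l⟩ * (algebraMap K[X] A (U a l j) * d) := by
    have h3 := congrArg b.equivFun.symm (funext fun n => hf a i (j, n))
    simp only [Module.Basis.equivFun_symm_apply] at h3
    simp only [hev, Finset.smul_sum, Finset.sum_mul, smul_mul_assoc]
    rw [Finset.sum_comm, ← Fintype.sum_prod_type (f := fun l => f ⟨y, i, l⟩ •
      (b l.2 * (algebraMap K[X] A (U a l.1 j) * d)))]
    calc _ = ∑ n, (∑ k, M a i k * f ⟨x, k, (j, n)⟩) • b n := by
          simp only [Finset.sum_smul, mul_smul]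
      _ = _ := h3
      _ = ∑ l, f ⟨y, i, l⟩ • ∑ n, V' a l (j, n) • b n := by
          simp only [Finset.sum_smul, mul_smul, Finset.smul_sum]
          exact Finset.sum_comm
      _ = _ := Finset.sum_congr rfl fun l _ => by
          simp only [V', Matrix.of_apply, b.sum_repr]
          rw [mul_comm (b l.2)]
  have h4 : ∀ r : K, algebraMap K[X] A (C r) = algebraMap K A r := fun r =>
    (IsScalarTower.algebraMap_apply K K[X] A r).symm
  calc _ = algebraMap K[X] A c * ∑ k, M a i k • ev f ⟨x, k, j⟩ := by
        simp [M', MatRep.map, Finset.mul_sum, mul_assoc, h4, Algebra.smul_def]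
    _ = (algebraMap K[X] A c * d) * ∑ l, ev f ⟨y, i, l⟩ * algebraMap K[X] A (U a l j) := by
        rw [h2, Finset.mul_sum, Finset.mul_sum]
        exact Finset.sum_congr rfl fun _ _ => by ring
    _ = _ := by rw [hd, one_mul]; rfl

theorem Descends.polynomial [Fintype Q] [∀ x y : Q, Fintype (x ⟶ y)] {F : Type u} [Field F]
    {M₀ : MatRep F ω} {K : Type u} [Field K] {M : MatRep K ω} (h : Descends M₀ K M)
    (L : Type u) [Field L] [Algebra K[X] L] [IsFractionRing K[X] L] :
    Descends M₀ L (M.map ((algebraMap K[X] L).comp C)) where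
  rep ι _ V := by
    obtain ⟨N, ι', _, V', hN, hι', hV'⟩ := exists_rep_specialization M ι V
    obtain ⟨N', ι'', i, V'', hN', hι'', hV''⟩ := h.rep ι' V'
    refine ⟨N' * N, ι'', i, V'', by positivity, fun x => ?_, hV''.trans ?_⟩
    · rw [hι'', hι', mul_assoc]
    · rw [mul_assoc]
      gcongr
  sub S hS := by
    obtain ⟨S', hS', hd⟩ := h.sub _ (isSubrep_specialization M S hS)
    exact ⟨S', hS', fun x => by rw [hd, finrank_specialization]⟩

end Descent

/-! ### First-order deformations of homomorphisms -/

section Perturbation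

variable {Q : Type v} [Quiver.{w} Q] {ω ι : Q → Type} [∀ x, Fintype (ω x)] [∀ x, Fintype (ι x)]

theorem mem_homSpace_map_iff {R S : Type*} [CommRing R] [CommRing S] {θ : R →+* S}
    (hθ : Function.Injective θ) {M : MatRep R ω} {V : MatRep R ι}
    {f : (Σ x : Q, ω x × ι x) → R} :
    (fun i => θ (f i)) ∈ homSpace (M.map θ) (V.map θ) ↔ f ∈ homSpace M V := by
  simp only [homSpace, LinearMap.mem_ker, funext_iff, coboundary_map, Pi.zero_apply,
    map_eq_zero_iff θ hθ]

variable {K : Type*} [Field K]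

/-- The representation `V + X V'` over the ring of polynomials. -/
noncomputable def pencil (V V' : MatRep K ι) : MatRep K[X] ι := fun _ _ a =>
  (V a).map (C : K →+* K[X]) + (X : K[X]) • (V' a).map (C : K →+* K[X])

theorem coeff_zero_mem_homSpace {M : MatRep K ω} {V V' : MatRep K ι}
    {m : (Σ x : Q, ω x × ι x) → K[X]} (hm : m ∈ homSpace (M.map C) (pencil V V')) :
    (fun i => (m i).coeff 0) ∈ homSpace M V := by
  rw [mem_homSpace_iff_sum] at hm ⊢
  intro x y a i j
  have := congrArg (fun p : K[X] => p.coeff 0) (hm a i j)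
  simpa [finsetSum_coeff, mul_coeff_zero, pencil, MatRep.map] using this

/-- Compare coefficients of `X` in `M m = m (V + X V')`. -/
theorem coeff_one_of_mem_homSpace {M : MatRep K ω} {V V' : MatRep K ι}
    {m : (Σ x : Q, ω x × ι x) → K[X]} (hm : m ∈ homSpace (M.map C) (pencil V V')) :
    coboundary M V (fun i => (m i).coeff 1) =
      fun c => (block (fun i => (m i).coeff 0) c.1.2.1 * V' c.1.2.2) c.2.1 c.2.2 := by
  rw [mem_homSpace_iff_sum] at hm
  ext ⟨⟨x, y, a⟩, i, j⟩
  have := congrArg (fun p : K[X] => p.coeff 1) (hm a i j)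
  simp only [finsetSum_coeff, pencil, MatRep.map, Matrix.map_apply, Matrix.add_apply,
    Matrix.smul_apply, smul_eq_mul, coeff_C_mul, mul_add, coeff_add, coeff_mul_C,
    mul_left_comm _ X, coeff_X_mul, mul_coeff_zero, coeff_C_zero, Finset.sum_add_distrib] at this
  rw [coboundary_apply, this]
  simp [block, Matrix.mul_apply]

/-- The sum over the vertices of the ranks of a family of matrices. -/
noncomputable def totalRank {K : Type*} [Field K] [Fintype Q] (f : (Σ x : Q, ω x × ι x) → K) : ℕ :=
  ∑ x, Module.finrank K (LinearMap.range (block f x).mulVecLin)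

variable [Fintype Q] {L : Type*} [Field L] [Algebra K[X] L] [IsFractionRing K[X] L]

omit [Quiver.{w} Q] in
/-- If the rank does not increase under a deformation of `f`, then the first order part of the
deformation maps the kernel of `f` to the image of `f`. -/
theorem coeff_one_mem_range (m : (Σ x : Q, ω x × ι x) → K[X])
    (hrank : totalRank (fun i => algebraMap K[X] L (m i)) ≤ totalRank (fun i => (m i).coeff 0))
    (x : Q) (v : ι x → K) (hv : (block (fun i => (m i).coeff 0) x).mulVec v = 0) :
    (block (fun i => (m i).coeff 1) x).mulVec v ∈
      LinearMap.range (block (fun i => (m i).coeff 0) x).mulVecLin := by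
  set Y : ∀ x, Submodule L (ω x → L) := fun x =>
    LinearMap.range (block (fun i => algebraMap K[X] L (m i)) x).mulVecLin with hY
  set I : ∀ x, Submodule K (ω x → K) := fun x =>
    LinearMap.range (block (fun i => (m i).coeff 0) x).mulVecLin with hI
  have hmem : ∀ x (v : ι x → K),
      (fun i => algebraMap K[X] L (∑ j, m ⟨x, i, j⟩ * C (v j))) ∈ Y x := fun x v =>
    ⟨fun j => algebraMap K[X] L (C (v j)), by
      ext i; simp [block, Matrix.mulVec, dotProduct]⟩
  have hle : ∀ x, I x ≤ specialization K (Y x) := by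
    rintro x _ ⟨v, rfl⟩
    exact ⟨_, hmem x v, fun i => by
      simp [block, Matrix.mulVec, dotProduct, finsetSum_coeff, mul_coeff_zero]⟩
  have hfin : ∀ x, Module.finrank K (I x) ≤ Module.finrank L (Y x) := fun x => by
    rw [← finrank_specialization (K := K) (Y x)]
    exact Submodule.finrank_mono (hle x)
  -- Specialization cannot raise the rank at any vertex, so the bound on total ranks forces equality
  -- at each one.
  have heq : I x = specialization K (Y x) := by
    refine Submodule.eq_of_le_of_finrank_le (hle x) ?_
    rw [finrank_specialization]
    exact ((Finset.sum_eq_sum_iff_of_le fun x _ => hfin x).mp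
      (le_antisymm (Finset.sum_le_sum fun x _ => hfin x) hrank) x (Finset.mem_univ x)).ge
  change _ ∈ I x
  rw [heq]
  -- For `v` in the kernel of the constant term, `m v` is divisible by `X`; the quotient still lies
  -- in the image over `L`, and its value at `0` is the first-order part applied to `v`.
  have hp : ∀ i, ∑ j, m ⟨x, i, j⟩ * C (v j) = X * (∑ j, m ⟨x, i, j⟩ * C (v j)).divX := fun i => by
    have h0 : (∑ j, m ⟨x, i, j⟩ * C (v j)).coeff 0 = 0 := by
      have := congrFun hv i
      simpa [block, Matrix.mulVec, dotProduct, finsetSum_coeff, mul_coeff_zero] using this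
    conv_lhs => rw [← divX_mul_X_add (∑ j, m ⟨x, i, j⟩ * C (v j)), h0, map_zero, add_zero, mul_comm]
  have hX : algebraMap K[X] L X ≠ 0 := by simp
  refine ⟨fun i => (∑ j, m ⟨x, i, j⟩ * C (v j)).divX, ?_, fun i => ?_⟩
  · convert (Y x).smul_mem (algebraMap K[X] L X)⁻¹ (hmem x v) using 1
    ext i
    rw [Pi.smul_apply, hp i, smul_eq_mul, map_mul, inv_mul_cancel_left₀ hX]
  · simp [coeff_divX, block, Matrix.mulVec, dotProduct, finsetSum_coeff]

/-- Homomorphisms from the pencil specialize into `homSpace M V` without loss of dimension, so the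
hypothesis makes them fill it. -/
theorem exists_lift_of_finrank_le {M : MatRep K ω} {V V' : MatRep K ι}
    (h : Module.finrank K (homSpace M V) ≤ Module.finrank L
      (homSpace (M.map ((algebraMap K[X] L).comp C)) ((pencil V V').map (algebraMap K[X] L)))) :
    Module.finrank L (homSpace (M.map ((algebraMap K[X] L).comp C))
        ((pencil V V').map (algebraMap K[X] L))) = Module.finrank K (homSpace M V) ∧
    ∀ f ∈ homSpace M V, ∃ m ∈ homSpace (M.map C) (pencil V V'), ∀ i, (m i).coeff 0 = f i := by
  set S := homSpace (M.map ((algebraMap K[X] L).comp C)) ((pencil V V').map (algebraMap K[X] L))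
  have hmem : ∀ m : (Σ x : Q, ω x × ι x) → K[X], (fun i => algebraMap K[X] L (m i)) ∈ S ↔
      m ∈ homSpace (M.map C) (pencil V V') := fun m =>
    mem_homSpace_map_iff (IsFractionRing.injective K[X] L)
  have hle : specialization K S ≤ homSpace M V := by
    rintro v ⟨m, hm, hv⟩
    rw [← funext hv]
    exact coeff_zero_mem_homSpace ((hmem m).mp hm)
  rw [← finrank_specialization (K := K) S] at h ⊢
  have heq := Submodule.eq_of_le_of_finrank_le hle h
  refine ⟨by rw [heq], fun f hf => ?_⟩
  rw [← heq] at hf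
  obtain ⟨m, hm, hv⟩ := hf
  exact ⟨m, (hmem m).mp hm, hv⟩

end Perturbation

/-! ### The dimension count -/

section Counting

variable {Q : Type v} {ω ι : Q → Type}

theorem block_add {R : Type*} [Semiring R] (f g : (Σ x : Q, ω x × ι x) → R) (x : Q) :
    block (f + g) x = block f x + block g x := rfl

theorem block_smul {R : Type*} [Semiring R] (r : R) (g : (Σ x : Q, ω x × ι x) → R) (x : Q) :
    block (r • g) x = r • block g x := rfl

variable [∀ x, Fintype (ω x)] [∀ x, Fintype (ι x)] {K : Type*} [Field K]

/-- The families of matrices that map the kernel of `f` to the image of `f`. -/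
def kerToRange (f : (Σ x : Q, ω x × ι x) → K) : Submodule K ((Σ x : Q, ω x × ι x) → K) where
  carrier := {g | ∀ x v, (block f x).mulVec v = 0 →
    (block g x).mulVec v ∈ LinearMap.range (block f x).mulVecLin}
  zero_mem' x v _ := ⟨0, by ext i; simp [block, Matrix.mulVec, dotProduct]⟩
  add_mem' hg hg' x v hv := by
    rw [block_add, Matrix.add_mulVec]
    exact Submodule.add_mem _ (hg x v hv) (hg' x v hv)
  smul_mem' r g hg x v hv := by
    rw [block_smul, Matrix.smul_mulVec]
    exact Submodule.smul_mem _ r (hg x v hv)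

/-- With a section `σ` of `f` onto its image, `g` is determined by `g ∘ σ`, which is arbitrary, and
by its values on the kernel vectors `v - σ (f v)`, which lie in the image. Letting `v` run over the
whole standard basis overcounts by the squares of the ranks, which only enlarges the error term. -/
theorem finrank_kerToRange_le [Fintype Q] (f : (Σ x : Q, ω x × ι x) → K) :
    Module.finrank K (kerToRange f) ≤ ∑ x, (Fintype.card (ι x) *
      Module.finrank K (LinearMap.range (block f x).mulVecLin) +
      Module.finrank K (LinearMap.range (block f x).mulVecLin) * Fintype.card (ω x)) := by
  classical
  have hsec : ∀ x, ∃ σ : LinearMap.range (block f x).mulVecLin →ₗ[K] (ι x → K),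
      (block f x).mulVecLin.rangeRestrict ∘ₗ σ = LinearMap.id := fun x =>
    LinearMap.exists_rightInverse_of_surjective _ (LinearMap.range_rangeRestrict _)
  choose σ hσ using hsec
  have hσ' : ∀ x u, (block f x).mulVec (σ x u) = u.1 := fun x u =>
    congrArg Subtype.val (LinearMap.congr_fun (hσ x) u)
  have hτ : ∀ x v, (block f x).mulVec (v - σ x ((block f x).mulVecLin.rangeRestrict v)) = 0 :=
    fun x v => by rw [Matrix.mulVec_sub, hσ']; exact sub_self _
  let Φ : kerToRange f →ₗ[K] ∀ x, ((ι x → LinearMap.range (block f x).mulVecLin) ×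
      (LinearMap.range (block f x).mulVecLin →ₗ[K] (ω x → K))) :=
    { toFun := fun g x => (fun j => ⟨_, g.2 x _ (hτ x (Pi.single j 1))⟩,
        (block g.1 x).mulVecLin ∘ₗ σ x)
      map_add' := fun g g' => by
        funext x
        refine Prod.ext (funext fun j => Subtype.ext ?_) (LinearMap.ext fun u => ?_)
        · exact Matrix.add_mulVec _ _ _
        · exact Matrix.add_mulVec _ _ _
      map_smul' := fun r g => by
        funext x
        refine Prod.ext (funext fun j => Subtype.ext ?_) (LinearMap.ext fun u => ?_)
        · exact Matrix.smul_mulVec _ _ _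
        · exact Matrix.smul_mulVec _ _ _ }
  have hΦ : Function.Injective Φ := by
    rw [injective_iff_map_eq_zero]
    intro g hg
    ext ⟨x, i, j⟩
    have h1 : (block g.1 x).mulVec
        (Pi.single j 1 - σ x ((block f x).mulVecLin.rangeRestrict (Pi.single j 1))) = 0 :=
      congrArg Subtype.val (congrFun (congrArg Prod.fst (congrFun hg x)) j)
    have h2 : (block g.1 x).mulVec (σ x ((block f x).mulVecLin.rangeRestrict (Pi.single j 1))) = 0 :=
      LinearMap.congr_fun (congrArg Prod.snd (congrFun hg x)) _
    rw [Matrix.mulVec_sub, h2, sub_zero] at h1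
    simpa [block] using congrFun h1 i
  refine (LinearMap.finrank_le_finrank_of_injective hΦ).trans_eq ?_
  rw [Module.finrank_pi_fintype]
  refine Finset.sum_congr rfl fun x _ => ?_
  rw [Module.finrank_prod, Module.finrank_pi_fintype, Module.finrank_linearMap]
  simp

variable [Quiver.{w} Q]

/-- Rank-nullity for `coboundary M V` on `kerToRange f`: by `h1` its kernel contains all
homomorphisms, and by `h2` its range contains all families of linear maps from the space of `V` at
`ta` to the image of `f` at `ha`. -/
theorem finrank_homSpace_add_le [Fintype Q] [∀ x y : Q, Fintype (x ⟶ y)]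
    {M : MatRep K ω} {V : MatRep K ι} (f : (Σ x : Q, ω x × ι x) → K)
    (h1 : homSpace M V ≤ kerToRange f)
    (h2 : ∀ V' : MatRep K ι, ∃ g ∈ kerToRange f, coboundary M V g =
      fun c => (block f c.1.2.1 * V' c.1.2.2) c.2.1 c.2.2) :
    Module.finrank K (homSpace M V) + ∑ a : Arrows Q, Fintype.card (ι a.1) *
      Module.finrank K (LinearMap.range (block f a.2.1).mulVecLin) ≤
    ∑ x, (Fintype.card (ι x) * Module.finrank K (LinearMap.range (block f x).mulVecLin) +
      Module.finrank K (LinearMap.range (block f x).mulVecLin) * Fintype.card (ω x)) := by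
  classical
  refine le_trans ?_ (finrank_kerToRange_le f)
  set δ := (coboundary M V).domRestrict (kerToRange f) with hδ
  have hk : Module.finrank K (homSpace M V) ≤ Module.finrank K (LinearMap.ker δ) := by
    let e : homSpace M V →ₗ[K] LinearMap.ker δ :=
      LinearMap.codRestrict _ (Submodule.inclusion h1) fun g => g.2
    exact LinearMap.finrank_le_finrank_of_injective (f := e) fun g g' hgg => by
      have := congrArg (fun z => z.1.1) hgg
      exact Subtype.ext this
  have hr : ∑ a : Arrows Q, Fintype.card (ι a.1) *
      Module.finrank K (LinearMap.range (block f a.2.1).mulVecLin) ≤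
      Module.finrank K (LinearMap.range δ) := by
    let Θ : (∀ a : Arrows Q, ι a.1 → LinearMap.range (block f a.2.1).mulVecLin) →ₗ[K]
        ((Σ a : Arrows Q, ω a.2.1 × ι a.1) → K) :=
      { toFun := fun t c => (t c.1 c.2.2).1 c.2.1
        map_add' := fun _ _ => rfl
        map_smul' := fun _ _ => rfl }
    have hΘ : ∀ t, Θ t ∈ LinearMap.range δ := fun t => by
      choose V' hV' using fun (a : Arrows Q) j => (t a j).2
      obtain ⟨g, hg, hgV⟩ := h2 fun x y a => Matrix.of fun l j => V' ⟨x, y, a⟩ j l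
      refine ⟨⟨g, hg⟩, ?_⟩
      rw [hδ, LinearMap.domRestrict_apply, hgV]
      ext c
      exact congrFun (hV' c.1 c.2.2) c.2.1
    have hinj : Function.Injective (Θ.codRestrict _ hΘ) := fun t t' htt => by
      funext a j
      ext i
      exact congrFun (congrArg Subtype.val htt) ⟨a, i, j⟩
    refine le_trans (le_of_eq ?_) (LinearMap.finrank_le_finrank_of_injective hinj)
    rw [Module.finrank_pi_fintype]
    exact Finset.sum_congr rfl fun a _ => by rw [Module.finrank_pi_fintype]; simp
  have := LinearMap.finrank_range_add_finrank_ker δ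
  lia

end Counting

/-! ### The extremal homomorphism and its image -/

section Optimal

variable {Q : Type v} [Quiver.{w} Q] {ω : Q → Type} [∀ x, Fintype (ω x)]

/-- The lift `f + X g` along the constant pencil has first-order part `g`; this places every
homomorphism `g` in `kerToRange f`. -/
theorem block_add_X_smul_mem {ι : Q → Type} [∀ x, Fintype (ι x)] {K : Type*} [Field K]
    {M : MatRep K ω} {V : MatRep K ι} {f g : (Σ x : Q, ω x × ι x) → K} (hf : f ∈ homSpace M V)
    (hg : g ∈ homSpace M V) :
    (fun i => C (f i) + X * C (g i)) ∈ homSpace (M.map C) (pencil V 0) := by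
  have h : (pencil V 0) = V.map C := by
    funext x y a
    simp [pencil, MatRep.map, Matrix.map_zero]
  rw [h]
  exact Submodule.add_mem _ ((mem_homSpace_map_iff C_injective).mpr hf)
    (Submodule.smul_mem _ X ((mem_homSpace_map_iff C_injective).mpr hg))

variable [Fintype Q] [∀ x y : Q, Fintype (x ⟶ y)]

/-- Some multiple of a dimension vector has a representation whose space of homomorphisms to `M₀`
is at most the Euler form with a subrepresentation of `M₀`, up to a bounded error. -/
theorem exists_finrank_homSpace_le {F : Type u} [Field F] (M₀ : MatRep F ω)
    (ι : Q → Type) [∀ x, Fintype (ι x)] :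
    ∃ (N : ℕ) (ι' : Q → Type) (_ : ∀ x, Fintype (ι' x)) (V' : MatRep F ι')
      (S : ∀ x, Submodule F (ω x → F)), 0 < N ∧
      (∀ x, Fintype.card (ι' x) = N * Fintype.card (ι x)) ∧ IsSubrep M₀ S ∧
      Module.finrank F (homSpace M₀ V') + N * ∑ a : Arrows Q, Fintype.card (ι a.1) *
        Module.finrank F (S a.2.1) ≤
      N * ∑ x, (Fintype.card (ι x) * Module.finrank F (S x) +
        Module.finrank F (S x) * Fintype.card (ω x)) := by
  classical
  -- choose `V` with a minimal space of homomorphisms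
  have hex : ∃ (h : ℕ) (K : Type u) (_ : Field K) (M : MatRep K ω) (V : MatRep K ι),
      Descends M₀ K M ∧ Module.finrank K (homSpace M V) = h :=
    ⟨_, F, inferInstance, M₀, 0, Descends.refl M₀, rfl⟩
  set h := Nat.find hex
  have hmin : ∀ (K : Type u) [Field K] (M : MatRep K ω) (V : MatRep K ι), Descends M₀ K M →
      h ≤ Module.finrank K (homSpace M V) := fun K _ M V hM =>
    Nat.find_min' hex ⟨K, _, M, V, hM, rfl⟩
  -- and among the homomorphisms from such `V` one of maximal rank
  let P : ℕ → Prop := fun r => ∃ (K : Type u) (_ : Field K) (M : MatRep K ω) (V : MatRep K ι)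
    (f : (Σ x : Q, ω x × ι x) → K), Descends M₀ K M ∧ Module.finrank K (homSpace M V) = h ∧
      f ∈ homSpace M V ∧ totalRank f = r
  have hP : ∃ r, P r := by
    obtain ⟨K, i, M, V, hM, hV⟩ := Nat.find_spec hex
    exact ⟨_, K, i, M, V, 0, hM, hV, Submodule.zero_mem _, rfl⟩
  have hbdd : ∀ r, P r → r ≤ ∑ x, Fintype.card (ω x) := by
    rintro r ⟨K, _, M, V, f, _, _, _, rfl⟩
    exact Finset.sum_le_sum fun x _ => (Submodule.finrank_le _).trans_eq (by simp)
  obtain ⟨K, _, M, V, f, hM, hV, hf, hfr⟩ : P (sSup {r | P r}) :=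
    Nat.sSup_mem hP ⟨_, hbdd⟩
  have hmax : ∀ (K : Type u) [Field K] (M : MatRep K ω) (V : MatRep K ι), Descends M₀ K M →
      Module.finrank K (homSpace M V) = h → ∀ g ∈ homSpace M V, totalRank g ≤ totalRank f :=
    fun K' _ M' V' hM' hV' g hg => hfr ▸ le_csSup ⟨_, hbdd⟩ ⟨K', _, M', V', g, hM', hV', hg, rfl⟩
  let L := FractionRing K[X]
  have hML := hM.polynomial L
  -- Minimality of `h` applies to the pencil over `L`, since `L` also satisfies `Descends`.
  have hlift := fun V' : MatRep K ι => exists_lift_of_finrank_le (L := L) (M := M) (V := V)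
    (V' := V') (hV ▸ hmin L _ _ hML)
  have hdef : ∀ (V' : MatRep K ι) (m), m ∈ homSpace (M.map C) (pencil V V') →
      (∀ i, (m i).coeff 0 = f i) → (fun i => (m i).coeff 1) ∈ kerToRange f := by
    intro V' m hm hmf x v
    rw [← funext hmf]
    refine coeff_one_mem_range (L := L) m ?_ x v
    rw [funext hmf]
    exact hmax L _ _ hML ((hlift V').1.trans hV) _
      ((mem_homSpace_map_iff (IsFractionRing.injective K[X] L)).mpr hm)
  have hmain := finrank_homSpace_add_le (M := M) (V := V) f
    (fun g hg => by
      have := hdef 0 _ (block_add_X_smul_mem hf hg) (by simp)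
      simpa [coeff_C] using this)
    (fun V' => by
      obtain ⟨m, hm, hmf⟩ := (hlift V').2 f hf
      refine ⟨_, hdef V' m hm hmf, ?_⟩
      rw [coeff_one_of_mem_homSpace hm, funext hmf])
  -- The image of `f` is the subrepresentation sought, carried down to `M₀`.
  obtain ⟨S, hS, hSd⟩ := hM.sub (fun x => LinearMap.range (block f x).mulVecLin) (by
    rintro x y a _ ⟨v, rfl⟩
    refine ⟨(V a).mulVec v, ?_⟩
    rw [Matrix.mulVecLin_apply, Matrix.mulVecLin_apply, Matrix.mulVec_mulVec, Matrix.mulVec_mulVec,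
      mem_homSpace_iff.mp hf a])
  obtain ⟨N, ι', i, V', hN, hι', hV'⟩ := hM.rep ι V
  refine ⟨N, ι', i, V', S, hN, hι', hS, ?_⟩
  simp only [hSd]
  calc _ ≤ N * _ + N * _ := Nat.add_le_add_right hV' _
    _ = N * (_ + _) := (mul_add _ _ _).symm
    _ ≤ _ := Nat.mul_le_mul_left N hmain

end Optimal

/-! ### The Euler form as `hom - ext` -/

section ShortExact

variable {F : Type*} [Field F] {C : Type*} [Category* C] [Abelian C] [Linear F C] [HasExt.{u} C]

open Abelian in
/-- Dimension count in the long exact sequence of an injective copresentation. -/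
theorem finrank_hom_add_finrank_hom {S : ShortComplex C} (hS : S.ShortExact) [Injective S.X₂]
    (V : C) [FiniteDimensional F (V ⟶ S.X₂)] [FiniteDimensional F (V ⟶ S.X₃)] :
    Module.finrank F (V ⟶ S.X₁) + Module.finrank F (V ⟶ S.X₃) =
      Module.finrank F (V ⟶ S.X₂) + Module.finrank F (Ext V S.X₁ 1) := by
  let δ : (V ⟶ S.X₃) →ₗ[F] Ext V S.X₁ 1 :=
    { toFun := fun f => (Ext.mk₀ f).comp hS.extClass (zero_add 1)
      map_add' := fun f g => by rw [Ext.mk₀_add, Ext.add_comp]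
      map_smul' := fun r f => by rw [Ext.mk₀_smul, Ext.smul_comp]; rfl }
  have hδ : LinearMap.range δ = ⊤ := by
    rw [LinearMap.range_eq_top]
    intro x
    obtain ⟨y, hy⟩ := Ext.covariant_sequence_exact₁ V hS x (Ext.eq_zero_of_injective _)
      (zero_add 1)
    obtain ⟨f, rfl⟩ := (Ext.mk₀_bijective V S.X₃).2 y
    exact ⟨f, hy⟩
  have hker : LinearMap.ker δ = LinearMap.range (Linear.rightComp F V S.g) := by
    ext f
    constructor
    · intro hf
      obtain ⟨y, hy⟩ := Ext.covariant_sequence_exact₃ V hS (Ext.mk₀ f) (zero_add 1) hf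
      obtain ⟨g, rfl⟩ := (Ext.mk₀_bijective V S.X₂).2 y
      rw [Ext.mk₀_comp_mk₀] at hy
      exact ⟨g, (Ext.mk₀_bijective V S.X₃).1 hy⟩
    · rintro ⟨g, rfl⟩
      change (Ext.mk₀ (g ≫ S.g)).comp hS.extClass (zero_add 1) = 0
      rw [← Ext.mk₀_comp_mk₀_assoc, hS.comp_extClass, Ext.comp_zero]
  have := hS.mono_f
  have hinj : Function.Injective (Linear.rightComp F V S.f) := fun f g h =>
    (cancel_mono S.f).mp h
  have hker' : LinearMap.ker (Linear.rightComp F V S.g) =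
      LinearMap.range (Linear.rightComp F V S.f) := by
    ext f
    constructor
    · exact fun hf => ⟨hS.exact.lift f hf, hS.exact.lift_f f hf⟩
    · rintro ⟨g, rfl⟩
      change (g ≫ S.f) ≫ S.g = 0
      rw [Category.assoc, S.zero, Limits.comp_zero]
  have h1 := LinearMap.finrank_range_add_finrank_ker δ
  have h2 := LinearMap.finrank_range_add_finrank_ker (Linear.rightComp F V S.g)
  rw [hδ, finrank_top, hker] at h1
  rw [hker', LinearMap.finrank_range_of_inj hinj] at h2
  lia

end ShortExact

section Paths

variable {Q : Type v} [Quiver.{w} Q]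

/-- The list of arrows of a path. -/
def arrowList {x : Q} : ∀ {y : Q}, Quiver.Path x y → List (Arrows Q)
  | _, .nil => []
  | _, .cons p a => ⟨_, _, a⟩ :: arrowList p

theorem arrowList_injective {x y : Q} :
    Function.Injective (arrowList : Quiver.Path x y → List (Arrows Q)) := by
  intro p q h
  induction p with
  | nil =>
    cases q with
    | nil => rfl
    | cons q b => simp [arrowList] at h
  | cons p a ih =>
    cases q with
    | nil => simp [arrowList] at h
    | cons q b =>
      simp only [arrowList, List.cons.injEq] at h
      obtain ⟨h1, h2⟩ := h
      cases h1
      rw [ih h2]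

/-- Paths are countably many, hence small in every universe; `coinduced` uses this to take values in
`ModuleCat.{u}`. -/
instance [Fintype Q] [∀ x y : Q, Fintype (x ⟶ y)] : LocallySmall.{u} (Paths Q) where
  hom_small x y := by
    have : Countable (x ⟶ y) := Function.Injective.countable
      (arrowList_injective (Q := Q) (x := x) (y := y))
    infer_instance

end Paths

/-! ### Coinduced representations and the standard injective coresolution -/

section Coinduced

variable {F : Type u} [Field F] {C : Type v} [Category.{w} C] [LocallySmall.{u} C]
variable {T : Type*} [Finite T] (t : T → C) (N : T → ModuleCat.{u} F)

/-- The functor coinduced from vector spaces `N i` at the objects `t i`. -/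
noncomputable def coinduced : C ⥤ ModuleCat.{u} F where
  obj y := ModuleCat.of F (Shrink.{u} (∀ i, (y ⟶ t i) → N i))
  map {y y'} p := ModuleCat.ofHom ((Shrink.linearEquiv F _).symm.toLinearMap ∘ₗ
    (LinearMap.pi fun i => LinearMap.pi fun q : y' ⟶ t i =>
      LinearMap.proj (p ≫ q) ∘ₗ LinearMap.proj i) ∘ₗ (Shrink.linearEquiv F _).toLinearMap)
  map_id y := by
    refine ModuleCat.hom_ext (LinearMap.ext fun g => (Shrink.linearEquiv F _).injective ?_)
    ext i q
    simp
  map_comp {y y' y''} p q := by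
    refine ModuleCat.hom_ext (LinearMap.ext fun g => (Shrink.linearEquiv F _).injective ?_)
    ext i r
    simp

/-- The elements of a coinduced functor as families of functions on morphisms. -/
noncomputable def coinducedEquiv (y : C) :
    (coinduced t N).obj y ≃ₗ[F] (∀ i, (y ⟶ t i) → N i) := Shrink.linearEquiv F _

theorem coinducedEquiv_map {y y' : C} (p : y ⟶ y') (g : (coinduced t N).obj y) (i : T)
    (q : y' ⟶ t i) :
    coinducedEquiv t N y' ((coinduced t N).map p g) i q = coinducedEquiv t N y g i (p ≫ q) := by
  exact congrFun (congrFun ((Shrink.linearEquiv F _).apply_symm_apply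
    (fun i (q : y' ⟶ t i) => coinducedEquiv t N y g i (p ≫ q))) i) q

/-- The value at a morphism `q` of an element of a coinduced functor. -/
noncomputable def coinducedEval {y : C} (i : T) (q : y ⟶ t i) : (coinduced t N).obj y →ₗ[F] N i :=
  LinearMap.proj q ∘ₗ LinearMap.proj i ∘ₗ (coinducedEquiv t N y).toLinearMap

theorem coinducedEval_map {y y' : C} (p : y ⟶ y') (g : (coinduced t N).obj y) (i : T)
    (q : y' ⟶ t i) :
    coinducedEval t N i q ((coinduced t N).map p g) = coinducedEval t N i (p ≫ q) g :=
  coinducedEquiv_map t N p g i q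

theorem coinduced_ext {y : C} {g g' : (coinduced t N).obj y}
    (h : ∀ i (q : y ⟶ t i), coinducedEval t N i q g = coinducedEval t N i q g') : g = g' :=
  (coinducedEquiv t N y).injective (funext fun i => funext fun q => h i q)

theorem exists_coinducedEval_eq {y : C} (c : ∀ i, (y ⟶ t i) → N i) :
    ∃ g : (coinduced t N).obj y, ∀ i q, coinducedEval t N i q g = c i q :=
  ⟨(coinducedEquiv t N y).symm c, fun i q =>
    congrFun (congrFun ((coinducedEquiv t N y).apply_symm_apply c) i) q⟩

/-- The component at `y` of the map to a coinduced functor given by a family of linear maps. -/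
noncomputable def coinducedLift {V : C ⥤ ModuleCat.{u} F} (ℓ : ∀ i, V.obj (t i) →ₗ[F] N i)
    (y : C) : V.obj y ⟶ (coinduced t N).obj y :=
  ModuleCat.ofHom ((coinducedEquiv t N y).symm.toLinearMap ∘ₗ
    LinearMap.pi fun i => LinearMap.pi fun q : y ⟶ t i => ℓ i ∘ₗ (V.map q).hom)

theorem coinducedEquiv_lift {V : C ⥤ ModuleCat.{u} F} (ℓ : ∀ i, V.obj (t i) →ₗ[F] N i)
    (y : C) (v : V.obj y) (i : T) (q : y ⟶ t i) :
    coinducedEquiv t N y (coinducedLift t N ℓ y v) i q = ℓ i (V.map q v) :=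
  congrFun (congrFun ((coinducedEquiv t N y).apply_symm_apply
    (fun i (q : y ⟶ t i) => ℓ i (V.map q v))) i) q

/-- Maps to a coinduced functor are families of linear maps. -/
noncomputable def coinducedHomEquiv (V : C ⥤ ModuleCat.{u} F) :
    (V ⟶ coinduced t N) ≃ₗ[F] ∀ i, V.obj (t i) →ₗ[F] N i where
  toFun φ := fun i => LinearMap.proj (𝟙 (t i)) ∘ₗ LinearMap.proj i ∘ₗ
    (coinducedEquiv t N (t i)).toLinearMap ∘ₗ (φ.app _).hom
  map_add' φ ψ := by ext; simp
  map_smul' r φ := by ext; simp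
  invFun ℓ :=
    { app := coinducedLift t N ℓ
      naturality := fun y y' p => by
        refine ModuleCat.hom_ext (LinearMap.ext fun v => (coinducedEquiv t N y').injective ?_)
        ext i q
        change coinducedEquiv t N y' (coinducedLift t N ℓ y' (V.map p v)) i q =
          coinducedEquiv t N y' ((coinduced t N).map p (coinducedLift t N ℓ y v)) i q
        rw [coinducedEquiv_map, coinducedEquiv_lift, coinducedEquiv_lift]
        simp }
  left_inv φ := by
    ext y v
    refine (coinducedEquiv t N y).injective ?_
    ext i q
    refine (coinducedEquiv_lift t N _ y v i q).trans ?_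
    change coinducedEquiv t N (t i) (φ.app (t i) (V.map q v)) i (𝟙 _) =
      coinducedEquiv t N y (φ.app y v) i q
    rw [NatTrans.naturality_apply, coinducedEquiv_map, Category.comp_id]
  right_inv ℓ := by
    ext i v
    refine (coinducedEquiv_lift t N _ (t i) v i (𝟙 _)).trans ?_
    simp

theorem coinducedHomEquiv_symm_app (V : C ⥤ ModuleCat.{u} F) (ℓ : ∀ i, V.obj (t i) →ₗ[F] N i)
    (y : C) (v : V.obj y) (i : T) (q : y ⟶ t i) :
    coinducedEval t N i q (((coinducedHomEquiv t N V).symm ℓ).app y v) =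
      ℓ i (V.map q v) := coinducedEquiv_lift t N ℓ y v i q

theorem coinducedHomEquiv_apply (V : C ⥤ ModuleCat.{u} F) (φ : V ⟶ coinduced t N)
    (i : T) (v : V.obj (t i)) :
    coinducedHomEquiv t N V φ i v = coinducedEquiv t N (t i) (φ.app (t i) v) i (𝟙 _) := rfl

theorem coinducedHomEquiv_comp {V V' : C ⥤ ModuleCat.{u} F} (f : V' ⟶ V) (φ : V ⟶ coinduced t N)
    (i : T) :
    coinducedHomEquiv t N V' (f ≫ φ) i = coinducedHomEquiv t N V φ i ∘ₗ (f.app (t i)).hom := by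
  ext v
  simp [coinducedHomEquiv_apply]

/-- By `coinducedHomEquiv`, extending a map along a monomorphism amounts to extending independent
linear maps at the objects `t i`. -/
instance : Injective (coinduced t N) where
  factors {V' V} g f _ := by
    have hf : ∀ i, ∃ r : V.obj (t i) →ₗ[F] V'.obj (t i), r ∘ₗ (f.app (t i)).hom = LinearMap.id :=
      fun i => LinearMap.exists_leftInverse_of_injective _
        (LinearMap.ker_eq_bot.mpr ((ModuleCat.mono_iff_injective (f.app (t i))).mp inferInstance))
    choose r hr using hf
    refine ⟨(coinducedHomEquiv t N V).symm fun i => coinducedHomEquiv t N V' g i ∘ₗ r i, ?_⟩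
    apply (coinducedHomEquiv t N V').injective
    ext i : 1
    rw [coinducedHomEquiv_comp, LinearEquiv.apply_symm_apply, LinearMap.comp_assoc, hr,
      LinearMap.comp_id]

end Coinduced

section EulerForm

variable {F : Type u} [Field F] {Q : Type v} [Quiver.{w} Q] [Fintype Q]
  [∀ x y : Q, Fintype (x ⟶ y)] (W : QuiverRep F Q)

/-- The first term of the standard injective coresolution. -/
noncomputable abbrev injectiveHull : QuiverRep F Q :=
  coinduced (fun x : Q => (Paths.of Q).obj x) fun x => W.obj ((Paths.of Q).obj x)

/-- The second term of the standard injective coresolution. -/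
noncomputable abbrev injectiveCosyzygy : QuiverRep F Q :=
  coinduced (fun a : Arrows Q => (Paths.of Q).obj a.1) fun a => W.obj ((Paths.of Q).obj a.2.1)

/-- The values of the elements of the first term of the standard injective coresolution. -/
noncomputable def hullEval {y : Paths Q} (x : Q) (q : y ⟶ (Paths.of Q).obj x) :
    (injectiveHull W).obj y →ₗ[F] W.obj ((Paths.of Q).obj x) :=
  coinducedEval (fun x : Q => (Paths.of Q).obj x) (fun x => W.obj ((Paths.of Q).obj x)) x q

/-- The values of the elements of the second term of the standard injective coresolution. -/
noncomputable def cosyzygyEval {y : Paths Q} (a : Arrows Q) (q : y ⟶ (Paths.of Q).obj a.1) :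
    (injectiveCosyzygy W).obj y →ₗ[F] W.obj ((Paths.of Q).obj a.2.1) :=
  coinducedEval (fun a : Arrows Q => (Paths.of Q).obj a.1)
    (fun a => W.obj ((Paths.of Q).obj a.2.1)) a q

/-- The embedding into the first term of the standard injective coresolution. -/
noncomputable def coresolutionι : W ⟶ injectiveHull W :=
  (coinducedHomEquiv _ _ W).symm fun _ => LinearMap.id

/-- The differential of the standard injective coresolution. -/
noncomputable def coresolutionπ : injectiveHull W ⟶ injectiveCosyzygy W :=
  (coinducedHomEquiv (fun a : Arrows Q => (Paths.of Q).obj a.1)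
      (fun a => W.obj ((Paths.of Q).obj a.2.1)) _).symm fun a =>
    (W.map ((Paths.of Q).map a.2.2)).hom ∘ₗ hullEval W a.1 (𝟙 _) -
      hullEval W a.2.1 ((Paths.of Q).map a.2.2)

theorem hullEval_ι {y : Paths Q} (v : W.obj y) (x : Q) (p : y ⟶ (Paths.of Q).obj x) :
    hullEval W x p ((coresolutionι W).app y v) = W.map p v :=
  coinducedHomEquiv_symm_app _ _ W _ y v x p

theorem cosyzygyEval_π {y : Paths Q} (g : (injectiveHull W).obj y) (a : Arrows Q)
    (p : y ⟶ (Paths.of Q).obj a.1) :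
    cosyzygyEval W a p ((coresolutionπ W).app y g) =
      W.map ((Paths.of Q).map a.2.2) (hullEval W a.1 p g) -
        hullEval W a.2.1 (p ≫ (Paths.of Q).map a.2.2) g := by
  refine (coinducedHomEquiv_symm_app (fun a : Arrows Q => (Paths.of Q).obj a.1)
    (fun a => W.obj ((Paths.of Q).obj a.2.1)) _ _ y g a p).trans ?_
  have h : ∀ (x : Q) (q : (Paths.of Q).obj a.1 ⟶ (Paths.of Q).obj x),
      hullEval W x q ((injectiveHull W).map p g) = hullEval W x (p ≫ q) g := fun x q =>
    coinducedEval_map _ _ p g x q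
  change W.map _ (hullEval W a.1 (𝟙 _) ((injectiveHull W).map p g)) -
    hullEval W a.2.1 _ ((injectiveHull W).map p g) = _
  rw [h, h, Category.comp_id]

theorem coresolution_zero : coresolutionι W ≫ coresolutionπ W = 0 := by
  ext y v
  refine coinduced_ext _ _ fun a p => (cosyzygyEval_π W ((coresolutionι W).app y v) a p).trans ?_
  rw [hullEval_ι, hullEval_ι, Functor.map_comp, ModuleCat.comp_apply, sub_self]
  exact (map_zero (coinducedEval (fun a : Arrows Q => (Paths.of Q).obj a.1)
    (fun a => W.obj ((Paths.of Q).obj a.2.1)) a p)).symm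

/-- The standard injective coresolution. -/
noncomputable def coresolution : ShortComplex (QuiverRep F Q) :=
  ShortComplex.mk (coresolutionι W) (coresolutionπ W) (coresolution_zero W)

/-- The solution of `W_a (g_q) - g_{qa} = c_{a, q}` on all paths starting at a vertex. -/
noncomputable def solvePaths {y : Q}
    (c : ∀ a : Arrows Q, Quiver.Path y a.1 → W.obj ((Paths.of Q).obj a.2.1)) :
    ∀ {x : Q}, Quiver.Path y x → W.obj ((Paths.of Q).obj x)
  | _, .nil => 0
  | _, .cons q a => W.map ((Paths.of Q).map a) (solvePaths c q) - c ⟨_, _, a⟩ q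

/-- At `y`, an element of the middle term is a family `g_q` over the paths `q` from `y`. Being in
the kernel means `g_{qa} = W_a g_q`, so `g` comes from its value at the trivial path. Surjectivity
is the recursion `solvePaths` along paths. -/
theorem coresolution_shortExact : (coresolution W).ShortExact := by
  have hP : JointlyReflectIsomorphisms
      (fun y : Paths Q => (evaluation (Paths Q) (ModuleCat.{u} F)).obj y) :=
    ⟨fun f _ => by
      rw [NatTrans.isIso_iff_isIso_app]
      assumption⟩
  rw [hP.shortExact_iff]
  intro y
  refine ModuleCat.shortComplex_shortExact _ ?_ ?_ ?_
  · intro g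
    change (coresolutionπ W).app y g = 0 ↔ ∃ v, (coresolutionι W).app y v = g
    constructor
    · intro hg
      refine ⟨hullEval W y (𝟙 y) g, coinduced_ext _ _ fun x p => ?_⟩
      refine (hullEval_ι W _ x p).trans ?_
      change _ = hullEval W x p g
      refine Paths.induction_fixed_source
        (fun {x} p => W.map p (hullEval W y (𝟙 y) g) = hullEval W x p g) ?_ ?_ p
      · rw [W.map_id]
        rfl
      · intro x z q a ih
        have h1 := cosyzygyEval_π W g ⟨_, _, a⟩ q
        rw [hg, map_zero, eq_comm, sub_eq_zero] at h1
        rw [W.map_comp, ModuleCat.comp_apply, ih]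
        exact h1
    · rintro ⟨v, rfl⟩
      exact LinearMap.congr_fun (congrArg ModuleCat.Hom.hom
        (NatTrans.congr_app (coresolution_zero W) y)) v
  · intro v v' h
    have h1 := hullEval_ι W v y (𝟙 y)
    have h2 := hullEval_ι W v' y (𝟙 y)
    change (coresolutionι W).app y v = (coresolutionι W).app y v' at h
    rw [h, h2] at h1
    have hid : ∀ v, W.map (𝟙 y) v = v := fun v => by rw [W.map_id]; rfl
    exact (hid v).symm.trans (h1.symm.trans (hid v'))
  · intro c
    obtain ⟨g, hg⟩ := exists_coinducedEval_eq (fun x : Q => (Paths.of Q).obj x)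
      (fun x => W.obj ((Paths.of Q).obj x)) (y := y)
      fun x q => solvePaths W (fun a q => cosyzygyEval W a q c) q
    refine ⟨g, coinduced_ext _ _ fun a q => ?_⟩
    refine (cosyzygyEval_π W g a q).trans ?_
    erw [hg, hg]
    exact sub_sub_cancel _ _

/-- Under `Hom(V, -)` the two injective terms acquire the vertex sum and the arrow sum of the Euler
form as dimensions. -/
theorem homDim_sub_extDim (V : QuiverRep F Q) (hV : ∀ x, FiniteDimensional F (V.obj x))
    (hW : ∀ x, FiniteDimensional F (W.obj x)) :
    (homDim V W : ℤ) - extDim V W = eulerForm (dimVec V) (dimVec W) := by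
  let := HasExt.standard (QuiverRep F Q)
  let e₂ := coinducedHomEquiv (fun x : Q => (Paths.of Q).obj x)
    (fun x => W.obj ((Paths.of Q).obj x)) V
  let e₃ := coinducedHomEquiv (fun a : Arrows Q => (Paths.of Q).obj a.1)
    (fun a => W.obj ((Paths.of Q).obj a.2.1)) V
  have : Injective (coresolution W).X₂ := inferInstanceAs (Injective (injectiveHull W))
  have : FiniteDimensional F (V ⟶ (coresolution W).X₂) := Module.Finite.equiv e₂.symm
  have : FiniteDimensional F (V ⟶ (coresolution W).X₃) := Module.Finite.equiv e₃.symm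
  have h1 := finrank_hom_add_finrank_hom (F := F) (coresolution_shortExact W) V
  have h2 : Module.finrank F (V ⟶ (coresolution W).X₂) = ∑ x, dimVec V x * dimVec W x := by
    refine e₂.finrank_eq.trans ?_
    rw [Module.finrank_pi_fintype]
    exact Finset.sum_congr rfl fun x _ => Module.finrank_linearMap ..
  have h3 : Module.finrank F (V ⟶ (coresolution W).X₃) =
      ∑ x, ∑ y, ∑ _a : x ⟶ y, dimVec V x * dimVec W y := by
    refine e₃.finrank_eq.trans ?_
    rw [Module.finrank_pi_fintype, Fintype.sum_sigma]
    refine Finset.sum_congr rfl fun x _ => ?_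
    rw [Fintype.sum_sigma]
    exact Finset.sum_congr rfl fun y _ => Finset.sum_congr rfl fun a _ =>
      Module.finrank_linearMap ..
  rw [h2, h3] at h1
  change homDim V W + _ = _ + extDim V W at h1
  rw [eulerForm]
  have h4 := congrArg (Nat.cast (R := ℤ)) h1
  push_cast at h4
  linarith

end EulerForm

/-! ### Translation between representations and matrices -/

section Lift

variable {F : Type u} [Field F] {Q : Type v} [Quiver.{w} Q]

/-- A homomorphism of representations from linear maps commuting with the arrows. -/
def liftHom {V W : QuiverRep F Q}
    (ℓ : ∀ x : Q, V.obj ((Paths.of Q).obj x) →ₗ[F] W.obj ((Paths.of Q).obj x))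
    (h : ∀ ⦃x y : Q⦄ (a : x ⟶ y), (W.map ((Paths.of Q).map a)).hom ∘ₗ ℓ x =
      ℓ y ∘ₗ (V.map ((Paths.of Q).map a)).hom) : V ⟶ W :=
  Paths.liftNatTrans (fun x => ModuleCat.ofHom (ℓ x)) fun {_ _} a =>
    ModuleCat.hom_ext (h a).symm

end Lift

section Matrices

variable {F : Type u} [Field F] {Q : Type v} [Quiver.{w} Q] {ω ι : Q → Type}
  [∀ x, Fintype (ω x)] [∀ x, Fintype (ι x)] [∀ x, DecidableEq (ω x)] [∀ x, DecidableEq (ι x)]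

/-- The matrices of a representation with respect to bases. -/
noncomputable def repMatrix (W : QuiverRep F Q)
    (b : ∀ x, Module.Basis (ω x) F (W.obj ((Paths.of Q).obj x))) : MatRep F ω := fun x y a =>
  LinearMap.toMatrix (b x) (b y) (W.map ((Paths.of Q).map a)).hom

/-- The matrices of a homomorphism of representations. -/
noncomputable def homMatrix (V W : QuiverRep F Q)
    (b' : ∀ x, Module.Basis (ι x) F (V.obj ((Paths.of Q).obj x)))
    (b : ∀ x, Module.Basis (ω x) F (W.obj ((Paths.of Q).obj x))) :
    (V ⟶ W) →ₗ[F] ((Σ x : Q, ω x × ι x) → F) where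
  toFun f := fun p => LinearMap.toMatrix (b' p.1) (b p.1) (f.app _).hom p.2.1 p.2.2
  map_add' f g := by ext; simp
  map_smul' r f := by ext; simp

omit [∀ x, DecidableEq (ω x)] in
theorem block_homMatrix {V W : QuiverRep F Q}
    (b' : ∀ x, Module.Basis (ι x) F (V.obj ((Paths.of Q).obj x)))
    (b : ∀ x, Module.Basis (ω x) F (W.obj ((Paths.of Q).obj x))) (f : V ⟶ W) (x : Q) :
    block (homMatrix V W b' b f) x =
      LinearMap.toMatrix (b' x) (b x) (f.app ((Paths.of Q).obj x)).hom := rfl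

omit [∀ x, DecidableEq (ω x)] in
theorem homMatrix_injective (V W : QuiverRep F Q)
    (b' : ∀ x, Module.Basis (ι x) F (V.obj ((Paths.of Q).obj x)))
    (b : ∀ x, Module.Basis (ω x) F (W.obj ((Paths.of Q).obj x))) :
    Function.Injective (homMatrix V W b' b) := by
  intro f g h
  suffices hfg : ∀ x : Q, f.app ((Paths.of Q).obj x) = g.app ((Paths.of Q).obj x) from
    NatTrans.ext (funext hfg)
  refine fun x => ModuleCat.hom_ext ?_
  apply (LinearMap.toMatrix (b' x) (b x)).injective
  have h1 := block_homMatrix b' b f x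
  rw [h, block_homMatrix] at h1
  exact h1.symm

theorem range_homMatrix (V W : QuiverRep F Q)
    (b' : ∀ x, Module.Basis (ι x) F (V.obj ((Paths.of Q).obj x)))
    (b : ∀ x, Module.Basis (ω x) F (W.obj ((Paths.of Q).obj x))) :
    LinearMap.range (homMatrix V W b' b) = homSpace (repMatrix W b) (repMatrix V b') := by
  ext f
  constructor
  · rintro ⟨f, rfl⟩
    rw [mem_homSpace_iff]
    intro x y a
    rw [block_homMatrix, block_homMatrix, repMatrix, repMatrix, ← LinearMap.toMatrix_comp,
      ← LinearMap.toMatrix_comp, ← ModuleCat.hom_comp, ← ModuleCat.hom_comp, f.naturality]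
  · intro hf
    refine ⟨liftHom (fun x => Matrix.toLin (b' x) (b x) (block f x)) fun x y a => ?_, ?_⟩
    · apply (LinearMap.toMatrix (b' x) (b y)).injective
      rw [LinearMap.toMatrix_comp (b' x) (b x) (b y), LinearMap.toMatrix_comp (b' x) (b' y) (b y),
        LinearMap.toMatrix_toLin, LinearMap.toMatrix_toLin]
      exact mem_homSpace_iff.mp hf a
    · ext ⟨x, i, j⟩
      exact congrFun (congrFun (LinearMap.toMatrix_toLin (b' x) (b x) (block f x)) i) j

theorem homDim_eq_finrank_homSpace (V W : QuiverRep F Q)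
    (b' : ∀ x, Module.Basis (ι x) F (V.obj ((Paths.of Q).obj x)))
    (b : ∀ x, Module.Basis (ω x) F (W.obj ((Paths.of Q).obj x))) :
    homDim V W = Module.finrank F (homSpace (repMatrix W b) (repMatrix V b')) := by
  rw [← range_homMatrix, LinearMap.finrank_range_of_inj (homMatrix_injective V W b' b), homDim]

theorem exists_repSpace_homDim_eq (W : QuiverRep F Q)
    (b : ∀ x, Module.Basis (ω x) F (W.obj ((Paths.of Q).obj x))) (V' : MatRep F ι) (γ : Q → ℕ)
    (hγ : ∀ x, Fintype.card (ι x) = γ x) :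
    ∃ V : RepSpace F γ, homDim V.toRep W = Module.finrank F (homSpace (repMatrix W b) V') := by
  let b' : ∀ x, Module.Basis (ι x) F (Fin (γ x) → F) := fun x =>
    (Pi.basisFun F (Fin (γ x))).reindex (Fintype.equivFinOfCardEq (hγ x)).symm
  let V : RepSpace F γ := fun x y a => Matrix.toLin (b' x) (b' y) (V' a)
  refine ⟨V, ?_⟩
  rw [homDim_eq_finrank_homSpace V.toRep W b' b]
  have h : repMatrix V.toRep b' = V' := by
    funext x y a
    refine Eq.trans ?_ (LinearMap.toMatrix_toLin (b' x) (b' y) (V' a))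
    refine congrArg (LinearMap.toMatrix (b' x) (b' y)) ?_
    exact congrArg ModuleCat.Hom.hom (Paths.lift_toPath _ a)
  rw [h]

theorem exists_mono_of_isSubrep (W : QuiverRep F Q)
    (b : ∀ x, Module.Basis (ω x) F (W.obj ((Paths.of Q).obj x)))
    (S : ∀ x, Submodule F (ω x → F)) (hS : IsSubrep (repMatrix W b) S) :
    ∃ (W' : QuiverRep F Q) (i : W' ⟶ W), Mono i ∧
      ∀ x, dimVec W' x = Module.finrank F (S x) := by
  let S' : ∀ x : Q, Submodule F (W.obj ((Paths.of Q).obj x)) := fun x =>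
    (S x).comap (b x).equivFun.toLinearMap
  have hS' : ∀ ⦃x y : Q⦄ (a : x ⟶ y), ∀ v ∈ S' x, (W.map ((Paths.of Q).map a)).hom v ∈ S' y := by
    intro x y a v hv
    have h : (repMatrix W b a).mulVec ((b x).equivFun v) =
        (b y).equivFun ((W.map ((Paths.of Q).map a)).hom v) :=
      LinearMap.toMatrix_mulVec_repr (b x) (b y) _ v
    change (b y).equivFun _ ∈ S y
    rw [← h]
    exact hS a _ hv
  let W' : QuiverRep F Q := Paths.lift
    { obj := fun x => ModuleCat.of F (S' x)
      map := fun {x y} a => ModuleCat.ofHom ((W.map ((Paths.of Q).map a)).hom.restrict (hS' a)) }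
  let i : W' ⟶ W := liftHom (fun x => (S' x).subtype) fun x y a => by
    have : W'.map ((Paths.of Q).map a) =
      ModuleCat.ofHom ((W.map ((Paths.of Q).map a)).hom.restrict (hS' a)) := Paths.lift_toPath _ a
    rw [this]
    rfl
  have hi : ∀ x, Mono (i.app x) := fun x =>
    (ModuleCat.mono_iff_injective (i.app x)).mpr (S' x).subtype_injective
  refine ⟨W', i, NatTrans.mono_of_mono_app i, fun x => ?_⟩
  exact (LinearEquiv.ofSubmodule' (b x).equivFun (S x)).finrank_eq

end Matrices

/-! ### Growth of the generic hom -/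

section Generic

variable {F : Type u} [Field F] {Q : Type v} [Quiver.{w} Q]

theorem IsGeneral.homDim_eq {γ : Q → ℕ} {W : QuiverRep F Q} {V : RepSpace F γ}
    (hV : IsGeneral W V) : homDim V.toRep W = genHom γ W :=
  le_antisymm (hV _) ((exists_isGeneral γ W).choose_spec V)

theorem genHom_le_homDim {γ : Q → ℕ} (W : QuiverRep F Q) (V : RepSpace F γ) :
    genHom γ W ≤ homDim V.toRep W := (exists_isGeneral γ W).choose_spec V

theorem dimVec_toRep {γ : Q → ℕ} (V : RepSpace F γ) : dimVec V.toRep = γ := by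
  funext x
  exact (Module.finrank_fin_fun F)

theorem finiteDimensional_toRep {γ : Q → ℕ} (V : RepSpace F γ) (x : Paths Q) :
    FiniteDimensional F (V.toRep.obj x) :=
  inferInstanceAs (FiniteDimensional F (Fin (γ x) → F))

theorem finiteDimensional_of_mono {W W' : QuiverRep F Q}
    (hW : ∀ x : Paths Q, FiniteDimensional F (W.obj x)) (i : W' ⟶ W) [Mono i] (x : Paths Q) :
    FiniteDimensional F (W'.obj x) :=
  have := hW x
  FiniteDimensional.of_injective (i.app x).hom
    ((ModuleCat.mono_iff_injective (i.app x)).mp inferInstance)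

theorem dimVec_le_of_mono {W W' : QuiverRep F Q}
    (hW : ∀ x : Paths Q, FiniteDimensional F (W.obj x)) (i : W' ⟶ W) [Mono i] (x : Q) :
    dimVec W' x ≤ dimVec W x :=
  have := hW ((Paths.of Q).obj x)
  LinearMap.finrank_le_finrank_of_injective (f := (i.app ((Paths.of Q).obj x)).hom)
    ((ModuleCat.mono_iff_injective (i.app _)).mp inferInstance)

theorem dimVec_add_of_shortExact {S : ShortComplex (QuiverRep F Q)} (hS : S.ShortExact)
    (h : ∀ x, FiniteDimensional F (S.X₂.obj x)) (x : Q) :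
    dimVec S.X₁ x + dimVec S.X₃ x = dimVec S.X₂ x := by
  have hx := hS.map_of_exact ((evaluation (Paths Q) (ModuleCat.{u} F)).obj ((Paths.of Q).obj x))
  have := h ((Paths.of Q).obj x)
  have h1 := LinearMap.finrank_range_add_finrank_ker (S.g.app ((Paths.of Q).obj x)).hom
  have h2 : LinearMap.range (S.f.app ((Paths.of Q).obj x)).hom =
      LinearMap.ker (S.g.app ((Paths.of Q).obj x)).hom := hx.exact.moduleCat_range_eq_ker
  have h3 : Function.Injective (S.f.app ((Paths.of Q).obj x)).hom := hx.moduleCat_injective_f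
  have h4 : Function.Surjective (S.g.app ((Paths.of Q).obj x)).hom := hx.moduleCat_surjective_g
  rw [← h2, LinearMap.finrank_range_of_inj h3, LinearMap.range_eq_top.mpr h4, finrank_top,
    add_comm] at h1
  exact h1

theorem homDim_le_of_mono {V W W' : QuiverRep F Q} (hV : ∀ x, FiniteDimensional F (V.obj x))
    (hW : ∀ x, FiniteDimensional F (W.obj x)) [Fintype Q] (i : W' ⟶ W) [Mono i] :
    homDim V W' ≤ homDim V W := by
  classical
  have : FiniteDimensional F (V ⟶ W) := FiniteDimensional.of_injective
    (homMatrix V W (fun x => Module.finBasis F _) fun x => Module.finBasis F _)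
    (homMatrix_injective V W _ _)
  exact LinearMap.finrank_le_finrank_of_injective (f := Linear.rightComp F V i)
    fun f g h => (cancel_mono i).mp h

variable [Fintype Q] [∀ x y : Q, Fintype (x ⟶ y)]

theorem eulerForm_nsmul (d : ℕ) (α β : Q → ℕ) : eulerForm (d • α) β = d * eulerForm α β := by
  simp only [eulerForm, mul_sub, Finset.mul_sum, Pi.smul_apply, smul_eq_mul, Nat.cast_mul,
    mul_assoc]

theorem eulerForm_add_right (α β β' : Q → ℕ) :
    eulerForm α (β + β') = eulerForm α β + eulerForm α β' := by
  simp only [eulerForm, Pi.add_apply, Nat.cast_add, mul_add, Finset.sum_add_distrib]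
  ring

theorem eulerForm_le_of_mono (α : Q → ℕ) {W W' : QuiverRep F Q}
    (hW : ∀ x : Paths Q, FiniteDimensional F (W.obj x)) (i : W' ⟶ W) [Mono i] :
    eulerForm α (dimVec W') ≤ ∑ x, (α x : ℤ) * dimVec W x := by
  have h1 : ∑ x, (α x : ℤ) * dimVec W' x ≤ ∑ x, (α x : ℤ) * dimVec W x :=
    Finset.sum_le_sum fun x _ => by gcongr; exact dimVec_le_of_mono hW i x
  have h2 : 0 ≤ ∑ x : Q, ∑ y : Q, ∑ _a : x ⟶ y, (α x : ℤ) * dimVec W' y := by positivity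
  rw [eulerForm]
  lia

omit [∀ x y : Q, Fintype (x ⟶ y)] in
-- A direct sum of general representations need not be general, hence only an inequality; it
-- suffices for Fekete's lemma.
theorem genHom_add_le (γ γ' : Q → ℕ) (W : QuiverRep F Q)
    (hW : ∀ x : Paths Q, FiniteDimensional F (W.obj x)) :
    genHom (γ + γ') W ≤ genHom γ W + genHom γ' W := by
  classical
  obtain ⟨V, hV⟩ := exists_isGeneral γ W
  obtain ⟨V', hV'⟩ := exists_isGeneral γ' W
  let b : ∀ x, Module.Basis (Fin (dimVec W x)) F (W.obj ((Paths.of Q).obj x)) := fun x =>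
    Module.finBasis F _
  let c : ∀ x, Module.Basis (Fin (γ x)) F (V.toRep.obj ((Paths.of Q).obj x)) := fun x =>
    Pi.basisFun F (Fin (γ x))
  let c' : ∀ x, Module.Basis (Fin (γ' x)) F (V'.toRep.obj ((Paths.of Q).obj x)) := fun x =>
    Pi.basisFun F (Fin (γ' x))
  let U : MatRep F fun x => Fin (γ x) ⊕ Fin (γ' x) := fun x y a =>
    Matrix.fromBlocks (repMatrix V.toRep c a) 0 0 (repMatrix V'.toRep c' a)
  obtain ⟨V'', hV''⟩ := exists_repSpace_homDim_eq W b U (γ + γ') (fun x => by simp)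
  let e : homSpace (repMatrix W b) U →ₗ[F] homSpace (repMatrix W b) (repMatrix V.toRep c) ×
      homSpace (repMatrix W b) (repMatrix V'.toRep c') :=
    { toFun := fun f => (⟨fun p => f.1 ⟨p.1, p.2.1, Sum.inl p.2.2⟩, by
          rw [mem_homSpace_iff_sum]
          intro x y a i j
          simpa [U] using mem_homSpace_iff_sum.mp f.2 a i (Sum.inl j)⟩,
        ⟨fun p => f.1 ⟨p.1, p.2.1, Sum.inr p.2.2⟩, by
          rw [mem_homSpace_iff_sum]
          intro x y a i j
          simpa [U] using mem_homSpace_iff_sum.mp f.2 a i (Sum.inr j)⟩)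
      map_add' := fun f g => rfl
      map_smul' := fun r f => rfl }
  have he : Function.Injective e := by
    intro f g h
    ext ⟨x, i, j | j⟩
    · exact congrFun (congrArg (fun z => z.1.1) h) ⟨x, i, j⟩
    · exact congrFun (congrArg (fun z => z.2.1) h) ⟨x, i, j⟩
  have h1 := LinearMap.finrank_le_finrank_of_injective he
  rw [Module.finrank_prod, ← hV'', ← homDim_eq_finrank_homSpace, ← homDim_eq_finrank_homSpace,
    hV.homDim_eq, hV'.homDim_eq] at h1
  exact (genHom_le_homDim W V'').trans h1

theorem mul_eulerForm_le_genHom (α : Q → ℕ) {W W' : QuiverRep F Q}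
    (hW : ∀ x : Paths Q, FiniteDimensional F (W.obj x)) (i : W' ⟶ W) [Mono i] :
    eulerForm α (dimVec W') ≤ genHom α W := by
  obtain ⟨V, hV⟩ := exists_isGeneral α W
  have h1 := homDim_sub_extDim W' V.toRep (finiteDimensional_toRep V)
    (finiteDimensional_of_mono hW i)
  have h2 := homDim_le_of_mono (finiteDimensional_toRep V) hW i
  rw [dimVec_toRep] at h1
  rw [← hV.homDim_eq]
  lia

/-- The error `∑ₓ rank fₓ · dim Wₓ` is at most `∑ₓ (dim Wₓ)²`, which does not involve `α`. -/
theorem exists_genHom_le (α : Q → ℕ) (W : QuiverRep F Q)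
    (hW : ∀ x : Paths Q, FiniteDimensional F (W.obj x)) :
    ∃ (N : ℕ) (W' : QuiverRep F Q) (i : W' ⟶ W), 0 < N ∧ Mono i ∧
      (genHom (N • α) W : ℤ) ≤ N * (eulerForm α (dimVec W') + ∑ x, (dimVec W x : ℤ) ^ 2) := by
  classical
  let b : ∀ x, Module.Basis (Fin (dimVec W x)) F (W.obj ((Paths.of Q).obj x)) := fun x =>
    Module.finBasis F _
  obtain ⟨N, ι', _, V', S, hN, hι', hS, h⟩ :=
    exists_finrank_homSpace_le (repMatrix W b) fun x => Fin (α x)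
  obtain ⟨V, hV⟩ := exists_repSpace_homDim_eq W b V' (N • α) fun x => by
    rw [hι', Fintype.card_fin]; rfl
  obtain ⟨W', i, hi, hd⟩ := exists_mono_of_isSubrep W b S hS
  refine ⟨N, W', i, hN, hi, ?_⟩
  have h1 := genHom_le_homDim W V
  rw [hV] at h1
  simp only [← hd, Fintype.card_fin, Fintype.sum_sigma] at h
  have h2 : ∑ x, dimVec W' x * dimVec W x ≤ ∑ x, dimVec W x ^ 2 :=
    Finset.sum_le_sum fun x _ => by rw [sq]; gcongr; exact dimVec_le_of_mono hW i x
  rw [Finset.sum_add_distrib] at h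
  have h3 := (Nat.add_le_add_right h1 _).trans (h.trans
    (Nat.mul_le_mul_left N (Nat.add_le_add_left h2 _)))
  have h4 := Nat.cast_le (α := ℤ).mpr h3
  push_cast at h4
  rw [eulerForm]
  linarith

theorem genHom_sub_genExt (α : Q → ℕ) (W : QuiverRep F Q)
    (hW : ∀ x : Paths Q, FiniteDimensional F (W.obj x)) :
    (genHom α W : ℤ) - genExt α W = eulerForm α (dimVec W) := by
  have := homDim_sub_extDim W (exists_isGeneral α W).choose.toRep (finiteDimensional_toRep _) hW
  rwa [dimVec_toRep] at this

/-- The generic dimension of the space of homomorphisms grows linearly, with slope the maximal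
value of the Euler form on subrepresentations. -/
theorem exists_tendsto_genHom_div (α : Q → ℕ) (W : QuiverRep F Q)
    (hW : ∀ x : Paths Q, FiniteDimensional F (W.obj x)) :
    ∃ μ : ℤ, IsGreatest {k : ℤ | ∃ (W' : QuiverRep F Q) (i : W' ⟶ W), Mono i ∧
        k = eulerForm α (dimVec W')} μ ∧
      Tendsto (fun d : ℕ => (genHom (d • α) W : ℝ) / d) atTop (𝓝 μ) := by
  obtain ⟨μ, hμ, hmax⟩ := Int.exists_greatest_of_bdd
    (P := fun k => ∃ (W' : QuiverRep F Q) (i : W' ⟶ W), Mono i ∧ k = eulerForm α (dimVec W'))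
    ⟨∑ x, (α x : ℤ) * dimVec W x, by
      rintro k ⟨W', i, hi, rfl⟩
      exact eulerForm_le_of_mono α hW i⟩ ⟨_, W, 𝟙 W, inferInstance, rfl⟩
  refine ⟨μ, ⟨hμ, fun k hk => hmax k hk⟩, ?_⟩
  obtain ⟨W', i, hi, rfl⟩ := hμ
  set μ := eulerForm α (dimVec W')
  have hsub : Subadditive fun d : ℕ => (genHom (d • α) W : ℝ) := fun m n => by
    beta_reduce
    rw [add_smul]
    exact_mod_cast genHom_add_le (m • α) (n • α) W hW
  have hbdd : BddBelow (Set.range fun d : ℕ => (genHom (d • α) W : ℝ) / d) :=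
    ⟨0, by rintro _ ⟨d, rfl⟩; positivity⟩
  have hlim := hsub.tendsto_lim hbdd
  have hlower : (μ : ℝ) ≤ hsub.lim := by
    refine ge_of_tendsto hlim ((eventually_gt_atTop 0).mono fun d hd => ?_)
    have h := mul_eulerForm_le_genHom (d • α) hW i
    rw [eulerForm_nsmul, mul_comm] at h
    rw [le_div_iff₀ (by exact_mod_cast hd)]
    exact_mod_cast h
  -- The limit is an infimum, so for each `d` the single index `N * d` bounds it by `μ + C / d`,
  -- although `N` depends on `d`.
  have hupper : hsub.lim ≤ μ := by
    have hC : Tendsto (fun d : ℕ => (μ : ℝ) + (∑ x, (dimVec W x : ℤ) ^ 2 : ℤ) / d) atTop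
        (𝓝 (μ + 0)) := tendsto_const_nhds.add (tendsto_const_div_atTop_nhds_zero_nat _)
    rw [add_zero] at hC
    refine ge_of_tendsto hC ((eventually_gt_atTop 0).mono fun d hd => ?_)
    obtain ⟨N, W'', j, hN, hj, h⟩ := exists_genHom_le (d • α) W hW
    have hμ' : eulerForm α (dimVec W'') ≤ μ := hmax _ ⟨W'', j, hj, rfl⟩
    rw [eulerForm_nsmul, smul_smul] at h
    have h1 : (genHom ((N * d) • α) W : ℤ) ≤ N * (d * μ + ∑ x, (dimVec W x : ℤ) ^ 2) :=
      h.trans (by gcongr)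
    have h2 : (genHom ((N * d) • α) W : ℝ) ≤ N * (d * μ + (∑ x, (dimVec W x : ℤ) ^ 2 : ℤ)) := by
      exact_mod_cast h1
    have hN' : (0 : ℝ) < N := by exact_mod_cast hN
    have hd' : (0 : ℝ) < d := by exact_mod_cast hd
    refine (hsub.lim_le_div hbdd (n := N * d) (by positivity)).trans ?_
    rw [Nat.cast_mul, div_le_iff₀ (by positivity)]
    refine h2.trans_eq ?_
    field_simp
  rwa [← le_antisymm hupper hlower]

end Generic

end QuiverNC

/-! ### The main theorem -/

theorem mainTheorem1 {F : Type u} [Field F] {Q : Type v} [Quiver.{w} Q]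
    [Fintype Q] [∀ x y : Q, Fintype (x ⟶ y)] (hQ : QuiverNC.IsAcyclic Q)
    (α : Q → ℕ) (W : QuiverNC.QuiverRep F Q)
    (hW : ∀ x : Paths Q, FiniteDimensional F (W.obj x)) :
    -- the dimensions of `Hom` and `Ext` do not depend on the general representation
    (∀ (d : ℕ) (V : QuiverNC.RepSpace F (d • α)), QuiverNC.IsGeneral W V →
      QuiverNC.homDim V.toRep W = QuiverNC.genHom (d • α) W ∧
      QuiverNC.extDim V.toRep W = QuiverNC.genExt (d • α) W) ∧
    -- the limits defining `ncext` and `nchom` exist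
    Tendsto (fun d : ℕ => (QuiverNC.genExt (d • α) W : ℝ) / d) atTop
      (𝓝 (QuiverNC.ncExt α W)) ∧
    Tendsto (fun d : ℕ => (QuiverNC.genHom (d • α) W : ℝ) / d) atTop
      (𝓝 (QuiverNC.ncHom α W)) ∧
    -- `ncext` is the maximum over the factor representations of `W`
    IsGreatest {r : ℝ | ∃ (W'' : QuiverNC.QuiverRep F Q) (p : W ⟶ W''), Epi p ∧
        r = -(QuiverNC.eulerForm α (QuiverNC.dimVec W'') : ℝ)} (QuiverNC.ncExt α W) ∧
    -- `nchom` is the maximum over the subrepresentations of `W`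
    IsGreatest {r : ℝ | ∃ (W' : QuiverNC.QuiverRep F Q) (i : W' ⟶ W), Mono i ∧
        r = (QuiverNC.eulerForm α (QuiverNC.dimVec W') : ℝ)} (QuiverNC.ncHom α W) := by
  obtain ⟨μ, ⟨⟨W₀, i₀, hi₀, hμ⟩, hmax⟩, hlim⟩ := QuiverNC.exists_tendsto_genHom_div α W hW
  -- For `0 → W' → W → W'' → 0` this gives `-⟨α, dim W''⟩ = ⟨α, dim W'⟩ - ⟨α, dim W⟩`, so the
  -- maximum over factors is the maximum over subrepresentations shifted by a constant.
  have hadd : ∀ {S : ShortComplex (QuiverNC.QuiverRep F Q)}, S.ShortExact →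
      (∀ x, FiniteDimensional F (S.X₂.obj x)) →
      QuiverNC.eulerForm α (QuiverNC.dimVec S.X₁) + QuiverNC.eulerForm α (QuiverNC.dimVec S.X₃) =
        QuiverNC.eulerForm α (QuiverNC.dimVec S.X₂) := fun {S} hS h => by
    rw [← QuiverNC.eulerForm_add_right]
    congr 1
    exact funext (QuiverNC.dimVec_add_of_shortExact hS h)
  have hlimExt : Tendsto (fun d : ℕ => (QuiverNC.genExt (d • α) W : ℝ) / d) atTop
      (𝓝 (μ - QuiverNC.eulerForm α (QuiverNC.dimVec W))) := by
    refine (hlim.sub_const _).congr' ((eventually_gt_atTop 0).mono fun d hd => ?_)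
    have h := QuiverNC.genHom_sub_genExt (d • α) W hW
    rw [QuiverNC.eulerForm_nsmul] at h
    have h' : (QuiverNC.genHom (d • α) W : ℝ) - QuiverNC.genExt (d • α) W =
        d * QuiverNC.eulerForm α (QuiverNC.dimVec W) := by exact_mod_cast h
    have hd' : (d : ℝ) ≠ 0 := by exact_mod_cast hd.ne'
    field_simp
    linarith
  have hHom : QuiverNC.ncHom α W = μ := hlim.limUnder_eq
  have hExt : QuiverNC.ncExt α W = μ - QuiverNC.eulerForm α (QuiverNC.dimVec W) :=
    hlimExt.limUnder_eq
  rw [hHom, hExt]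
  refine ⟨fun d V hV => ⟨hV.homDim_eq, ?_⟩, hlimExt, hlim, ⟨?_, ?_⟩, ⟨?_, ?_⟩⟩
  · have h1 := QuiverNC.homDim_sub_extDim W V.toRep (QuiverNC.finiteDimensional_toRep V) hW
    have h2 := QuiverNC.genHom_sub_genExt (d • α) W hW
    rw [QuiverNC.dimVec_toRep, hV.homDim_eq] at h1
    lia
  · let S : ShortComplex (QuiverNC.QuiverRep F Q) :=
      ShortComplex.mk i₀ (Limits.cokernel.π i₀) (Limits.cokernel.condition i₀)
    have hS : S.ShortExact :=
      { exact := S.exact_of_g_is_cokernel (Limits.cokernelIsCokernel i₀)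
        mono_f := hi₀
        epi_g := inferInstanceAs (Epi (Limits.cokernel.π i₀)) }
    refine ⟨_, Limits.cokernel.π i₀, inferInstance, ?_⟩
    have h := hadd hS hW
    rw [hμ, sub_eq_iff_eq_add, neg_add_eq_sub, eq_sub_iff_add_eq]
    exact_mod_cast h
  · rintro _ ⟨W'', p, hp, rfl⟩
    let S : ShortComplex (QuiverNC.QuiverRep F Q) :=
      ShortComplex.mk (Limits.kernel.ι p) p (Limits.kernel.condition p)
    have hS : S.ShortExact :=
      { exact := S.exact_of_f_is_kernel (Limits.kernelIsKernel p)
        mono_f := inferInstanceAs (Mono (Limits.kernel.ι p))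
        epi_g := hp }
    have h := hadd hS hW
    have h' := hmax ⟨_, Limits.kernel.ι p, inferInstance, rfl⟩
    change _ + QuiverNC.eulerForm α (QuiverNC.dimVec W'') =
      QuiverNC.eulerForm α (QuiverNC.dimVec W) at h
    change QuiverNC.eulerForm α (QuiverNC.dimVec S.X₁) ≤ μ at h'
    rw [le_sub_iff_add_le, neg_add_le_iff_le_add]
    exact_mod_cast (show QuiverNC.eulerForm α (QuiverNC.dimVec W) ≤
      QuiverNC.eulerForm α (QuiverNC.dimVec W'') + μ by lia)
  · exact ⟨W₀, i₀, hi₀, by rw [hμ]⟩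
  · rintro _ ⟨W', i, hi, rfl⟩
    exact_mod_cast hmax ⟨W', i, hi, rfl⟩
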